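/- Consider $\min_{x\in\mathbb R^n}\max_{y\in\mathbb R^m} f(x)+f_2(x)+\langle Ax,y\rangle-g^*(y)$, where $f(x)=\sum_i f_i(x_i)$ and $g(y)=\sum_j g_j(y_j)$ with $f_i,g_j:\mathbb R\to(-\infty,+\infty]$ proper, convex and lower semi-continuous, $g^*$ is the Fenchel conjugate of $g$, $f_2$ is convex and differentiable, $L_i$ is a Lipschitz constant of $\nabla_i f_2$ along the $i$-th coordinate, and $A\in\mathbb R^{m\times n}$ has no zero row and, for every $i$, $L_i>0$ or the $i$-th column $A_i$ is nonzero. Let $p_i>0$ with $\sum_i p_i=1$, $\underline p=\min_i p_i$, $J(i)=\{j:A_{j,i}\ne0\}$, $\pi_j=\sum_{i:A_{j,i}\neq 0}p_i$, $\theta_j=\pi_j/\underline p$, let $0<\gamma_0<1$, and for $s>0$ let $$\sigma^j(s)=\frac{s}{\theta_j\max_{i'}\|A_{i'}\|},\qquad \tau^i(s)=\frac{\gamma_0(2-\underline p/p_i)}{L_i+s\|A_i\|^2/\max_{i'}\|A_{i'}\|}.$$ A stage of PURE-CD with parameter $s_l>0$, $\tau=\tau(s_l)$, $\sigma=\sigma(s_l)$,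 started at $z_0=(x_0,y_0)=\tilde z_l$, computes $\bar y_{k+1}=\mathrm{prox}_{\sigma,g^*}(y_k+\sigma Ax_k)$ and $\bar x_{k+1}=\mathrm{prox}_{\tau,f}\big(x_k-\tau(\nabla f_2(x_k)+A^\top\bar y_{k+1})\big)$, draws $i_{k+1}$ with $\mathbb P(i_{k+1}=i)=p_i$ (independently of the other draws and of everything known at the start of the stage), sets $x_{k+1}^{i}=\bar x_{k+1}^{i}$ for $i=i_{k+1}$ and $x_{k+1}^i=x_k^i$ otherwise, and $y_{k+1}^j=\bar y_{k+1}^j+\sigma^j\theta_j(A(x_{k+1}-x_k))_j$ for $j\in J(i_{k+1})$ and $y_{k+1}^j=y_k^j$ otherwise. Let $\check y_0=y_0$, $\check y_{k+1}^j=\bar y_{k+1}^j$ for $j\in J(i_{k+1})$ and $\check y_{k+1}^j=\check y_k^j$ otherwise, and for $k\ge1$ let $z_k^{\mathrm{av}}=\frac1k\sum_{k'=1}^k(x_{k'},\check y_{k'})$. Let $\|(x,y)\|_\gamma^2=\sum_i\frac{x_i^2}{p_i\tau^i}+\sum_j\frac{y_j^2}{\pi_j\sigma^j}$, i.e. $\gamma=(p^{-1}\tau^{-1},\pi^{-1}\sigma^{-1})$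 with $\tau=\tau(s_l)$, $\sigma=\sigma(s_l)$. For a saddle point $z^*=(x^*,y^*)$ (that is, $0\in\partial f(x^*)+\nabla f_2(x^*)+A^\top y^*$ and $0\in\partial g^*(y^*)-Ax^*$) and $z=(x,y)$ let $$\Delta_l(z)=f(x)+f_2(x)-f(x^*)-f_2(x^*)+\langle A^\top y^*,x-x^*\rangle+\frac{\underline p}{2}\|z-z^*\|^2_{\gamma}.$$ Then there is a constant $C>0$, independent of $s_l$ (and of $k$, $\tilde z_l$ and the saddle point $z^*$), such that for all $k\ge1$, almost surely, for every saddle point $z^*$ (in particular for the projection of $\tilde z_l$ onto the set of saddle points), $$\mathbb E\big[\|z_k^{\mathrm{av}}-\tilde z_l\|_\gamma^2\,\big|\,\tilde z_l\big]\le C\,\Delta_l(\tilde z_l).$$ Here $\tilde z_l$ and $s_l$ may be random, and the conditional expectation may be taken given any $\sigma$-algebra that is independent of the draws of the stage and makes $\tilde z_l$ and $s_l$ measurable (for instance the one generated by $\tilde z_l$, when $s_l$ is deterministic). -/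

import Mathlib

open MeasureTheory ProbabilityTheory
open scoped ENNReal Matrix

noncomputable section

/-- `φ : ℝ → (-∞, +∞]` is proper, convex (its epigraph is convex) and lower semi-continuous. -/
structure IsProperConvexLSC (φ : ℝ → EReal) : Prop where
  ne_bot : ∀ t, φ t ≠ ⊥
  exists_ne_top : ∃ t, φ t ≠ ⊤
  convex_epigraph : Convex ℝ {q : ℝ × ℝ | φ q.1 ≤ (q.2 : EReal)}
  lsc : LowerSemicontinuous φ

/-- The Fenchel conjugate `φ* (v) = sup_t (t v - φ t)`. -/
def fenchelConj (φ : ℝ → EReal) (v : ℝ) : EReal :=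
  ⨆ t : ℝ, (((t * v : ℝ) : EReal) - φ t)

/-- `v ∈ ∂φ(t)`. -/
def IsSubgradient (φ : ℝ → EReal) (t v : ℝ) : Prop :=
  φ t ≠ ⊤ ∧ ∀ w : ℝ, φ t + ((v * (w - t) : ℝ) : EReal) ≤ φ w

/-- `u` minimizes `φ(w) + (w - v)² / (2 τ)` over `w`. -/
def IsProx (τ : ℝ) (φ : ℝ → EReal) (v u : ℝ) : Prop :=
  ∀ w : ℝ, φ u + (((u - v) ^ 2 / (2 * τ) : ℝ) : EReal)
    ≤ φ w + (((w - v) ^ 2 / (2 * τ) : ℝ) : EReal)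

/-- The proximal operator with step `τ`; for `φ` proper, convex and lower semi-continuous and
`τ > 0` the minimizer exists and is unique. -/
def prox (τ : ℝ) (φ : ℝ → EReal) (v : ℝ) : ℝ :=
  Classical.epsilon (IsProx τ φ v)

/-- Pairs `z = (x, y)` in `ℝⁿ × ℝᵐ`. -/
abbrev PrimalDual (n m : ℕ) : Type := (Fin n → ℝ) × (Fin m → ℝ)

/-- The problem `min_x f(x) + f₂(x) + g(Ax)` with `f(x) = ∑ᵢ fᵢ(xᵢ)` and `g(y) = ∑ⱼ gⱼ(yⱼ)`
separable, `f₂` convex and differentiable, and `L i` a Lipschitz constant of the `i`-th partial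
derivative of `f₂` along the `i`-th coordinate. -/
structure CompositeProblem (n m : ℕ) where
  f : Fin n → ℝ → EReal
  f₂ : (Fin n → ℝ) → ℝ
  g : Fin m → ℝ → EReal
  A : Matrix (Fin m) (Fin n) ℝ
  L : Fin n → ℝ
  f_proper : ∀ i, IsProperConvexLSC (f i)
  g_proper : ∀ j, IsProperConvexLSC (g j)
  f₂_convex : ConvexOn ℝ Set.univ f₂
  f₂_diff : Differentiable ℝ f₂
  f₂_lip : ∀ (i : Fin n) (x : Fin n → ℝ) (t : ℝ),
    |fderiv ℝ f₂ (x + Pi.single i t) (Pi.single i 1) - fderiv ℝ f₂ x (Pi.single i 1)| ≤ L i * |t|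

namespace CompositeProblem

variable {n m : ℕ} (P : CompositeProblem n m)

/-- The partial derivative `∇ᵢ f₂(x)`. -/
def grad₂ (x : Fin n → ℝ) (i : Fin n) : ℝ := fderiv ℝ P.f₂ x (Pi.single i 1)

/-- `z = (x, y)` is a saddle point of `f(x) + f₂(x) + ⟨Ax, y⟩ - g*(y)`:
`0 ∈ ∂f(x) + ∇f₂(x) + Aᵀy` and `0 ∈ ∂g*(y) - Ax`, coordinate by coordinate. -/
def IsSaddle (z : PrimalDual n m) : Prop :=
  (∀ i, IsSubgradient (P.f i) (z.1 i) (-(P.grad₂ z.1 i + (P.Aᵀ *ᵥ z.2) i))) ∧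
  (∀ j, IsSubgradient (fenchelConj (P.g j)) (z.2 j) ((P.A *ᵥ z.1) j))

/-- `π_j = ∑_{i ∈ I(j)} p_i`, where `I(j) = {i : A_{j,i} ≠ 0}`. -/
def piProb (p : Fin n → ℝ) (j : Fin m) : ℝ := ∑ i with P.A j i ≠ 0, p i

/-- `p̲ = min_i p_i`. -/
def pMin (p : Fin n → ℝ) : ℝ := ⨅ i, p i

/-- `θ_j = π_j / p̲`. -/
def theta (p : Fin n → ℝ) (j : Fin m) : ℝ := P.piProb p j / pMin p

/-- The Euclidean norm `‖A_i‖` of the `i`-th column of `A`. -/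
def colNorm (i : Fin n) : ℝ := Real.sqrt (∑ j, P.A j i ^ 2)

/-- `max_i ‖A_i‖`. -/
def maxColNorm : ℝ := ⨆ i, P.colNorm i

/-- Dual step sizes `σ^j(s) = s / (θ_j max_i ‖A_i‖)`. -/
def sigma (p : Fin n → ℝ) (s : ℝ) (j : Fin m) : ℝ := s / (P.theta p j * P.maxColNorm)

/-- Primal step sizes `τ^i(s) = γ (2 - p̲ / p_i) / (L_i + s ‖A_i‖² / max_i' ‖A_i'‖)`. -/
def tau (p : Fin n → ℝ) (γ s : ℝ) (i : Fin n) : ℝ :=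
  γ * (2 - pMin p / p i) / (P.L i + s * P.colNorm i ^ 2 / P.maxColNorm)

/-- `‖z‖²_{(p⁻¹τ⁻¹, π⁻¹σ⁻¹)}` with the step sizes given by `s`. -/
def wNormSq (p : Fin n → ℝ) (γ s : ℝ) (z : PrimalDual n m) : ℝ :=
  (∑ i, (p i)⁻¹ * (P.tau p γ s i)⁻¹ * z.1 i ^ 2) +
    ∑ j, (P.piProb p j)⁻¹ * (P.sigma p s j)⁻¹ * z.2 j ^ 2

/-- `ȳ_{k+1} = prox_{σ, g*}(y_k + σ A x_k)`. -/
def yBar (p : Fin n → ℝ) (s : ℝ) (z : PrimalDual n m) (j : Fin m) : ℝ :=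
  prox (P.sigma p s j) (fenchelConj (P.g j)) (z.2 j + P.sigma p s j * (P.A *ᵥ z.1) j)

/-- `x̄_{k+1} = prox_{τ, f}(x_k - τ (∇f₂(x_k) + Aᵀ ȳ_{k+1}))`. -/
def xBar (p : Fin n → ℝ) (γ s : ℝ) (z : PrimalDual n m) (i : Fin n) : ℝ :=
  prox (P.tau p γ s i) (P.f i)
    (z.1 i - P.tau p γ s i * (P.grad₂ z.1 i + (P.Aᵀ *ᵥ P.yBar p s z) i))

/-- `x_{k+1}` when coordinate `i` is drawn: only the `i`-th coordinate is updated. -/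
def xNext (p : Fin n → ℝ) (γ s : ℝ) (z : PrimalDual n m) (i : Fin n) : Fin n → ℝ :=
  Function.update z.1 i (P.xBar p γ s z i)

/-- `y_{k+1}` when coordinate `i` is drawn: `ȳ^j + σ^j θ_j (A (x_{k+1} - x_k))_j` for
`j ∈ J(i) = {j : A_{j,i} ≠ 0}`, unchanged otherwise. -/
def yNext (p : Fin n → ℝ) (γ s : ℝ) (z : PrimalDual n m) (i : Fin n) (j : Fin m) : ℝ :=
  if P.A j i ≠ 0 then
    P.yBar p s z j + P.sigma p s j * P.theta p j * (P.A *ᵥ (P.xNext p γ s z i - z.1)) j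
  else z.2 j

/-- The PURE-CD iterates `z_k` from `z_0`, where `d k` is the coordinate `i_{k+1}`. -/
def iter (p : Fin n → ℝ) (γ s : ℝ) (z₀ : PrimalDual n m) (d : ℕ → Fin n) :
    ℕ → PrimalDual n m
  | 0 => z₀
  | k + 1 =>
    (P.xNext p γ s (iter p γ s z₀ d k) (d k), P.yNext p γ s (iter p γ s z₀ d k) (d k))

/-- The modified dual sequence: `y̌_0 = y_0`, and `y̌_{k+1}^j = ȳ_{k+1}^j` for `j ∈ J(i_{k+1})`,
`y̌_{k+1}^j = y̌_k^j` otherwise. -/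
def yCheck (p : Fin n → ℝ) (γ s : ℝ) (z₀ : PrimalDual n m) (d : ℕ → Fin n) :
    ℕ → Fin m → ℝ
  | 0 => z₀.2
  | k + 1 => fun j =>
      if P.A j (d k) ≠ 0 then P.yBar p s (P.iter p γ s z₀ d k) j
      else yCheck p γ s z₀ d k j

/-- The averaged iterate `z_k^av = (1/k) ∑_{k'=1}^k (x_{k'}, y̌_{k'})`, for `k ≥ 1`. -/
def avg (p : Fin n → ℝ) (γ s : ℝ) (z₀ : PrimalDual n m) (d : ℕ → Fin n) (k : ℕ) :
    PrimalDual n m :=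
  (k : ℝ)⁻¹ • ∑ k' ∈ Finset.Icc 1 k, ((P.iter p γ s z₀ d k').1, P.yCheck p γ s z₀ d k')

/-- `D_p(x, z*) = f(x) + f₂(x) - f(x*) - f₂(x*) + ⟨Aᵀ y*, x - x*⟩`, possibly `+∞`
(`f(x*)` is finite at a saddle point). -/
def primalGap (zs : PrimalDual n m) (x : Fin n → ℝ) : EReal :=
  ((∑ i, P.f i (x i)) - ∑ i, P.f i (zs.1 i)) +
    ((P.f₂ x - P.f₂ zs.1 + ∑ i, (P.Aᵀ *ᵥ zs.2) i * (x i - zs.1 i) : ℝ) : EReal)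

/-- The weighted distance
`Δ(z) = D_p(x, z*) + (p̲/2) ‖x - x*‖²_{τ⁻¹p⁻¹} + (p̲/2) ‖y - y*‖²_{σ⁻¹π⁻¹}`
to the saddle point `z*`, with the step sizes given by `s`. -/
def Delta (p : Fin n → ℝ) (γ s : ℝ) (zs z : PrimalDual n m) : EReal :=
  P.primalGap zs z.1 + ((pMin p / 2 * P.wNormSq p γ s (z - zs) : ℝ) : EReal)

end CompositeProblem

end

/-! ### Subgradients, proximal maps and conjugates in one variable. -/

noncomputable section

/-! Write q for the least probability and K = s / max ‖A_i‖. The step sizes are tuned so that σ^j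
θ_j = K for every row, hence σ^j π_j = K q: the dual weights are all 1 / (K q), and π_j is exactly
the probability that row j is refreshed. The proof follows the Lyapunov function V = Δ + (1 - γ)/4 ·
q · ‖y - y̌‖², with the dual weights in the last norm. Its conditional mean does not increase in one
step. The primal and dual prox inequalities, weighted by q and p_i - q, make all terms in Aᵀȳ
cancel; the term q · D_p that remains is nonnegative at a saddle point and is dropped. Since γ < 1,
the quadratic term in x̄ - x keeps some slack, and this slack pays for the change of y - y̌, which
equals K A (x_{k+1} - x_k) on refreshed rows. This is `lyapunov_mean_le`. As y̌_0 = y_0, V starts at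
Δ, so the mean of V stays below Δ. Every part of V is nonnegative, so V controls the distance of
(x_k, y̌_k) to z_0 through z*; convexity of the square passes this to the average
(`IsSaddle.wordMean_wNormSq_avg_le`). All weights depend on s, but the factor 24 / (q (1 - γ)) does
not. Probability enters only through `condLExp_draws_ae_eq`: given the initial σ-algebra, the
conditional expectation is almost surely a finite weighted sum over words of draws. That identity
does not involve z*, so a single null set serves all saddle points, and the rest is a deterministic
inequality for each ω. -/

theorem IsSubgradient.toReal_add_le {φ : ℝ → EReal} {t v w : ℝ} (h : IsSubgradient φ t v)
    (hbot : ∀ u, φ u ≠ ⊥) (hw : φ w ≠ ⊤) :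
    (φ t).toReal + v * (w - t) ≤ (φ w).toReal := by
  have h1 := h.2 w
  rw [← EReal.coe_toReal h.1 (hbot t), ← EReal.coe_toReal hw (hbot w)] at h1
  exact_mod_cast h1

theorem IsSubgradient.mul_sub_nonneg {φ : ℝ → EReal} {t v t' v' : ℝ} (h : IsSubgradient φ t v)
    (h' : IsSubgradient φ t' v') (hbot : ∀ u, φ u ≠ ⊥) :
    0 ≤ (v' - v) * (t' - t) := by
  have h1 := h.toReal_add_le hbot h'.1
  have h2 := h'.toReal_add_le hbot h.1
  linarith

namespace IsProperConvexLSC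

variable {φ : ℝ → EReal}

theorem le_combo (hφ : IsProperConvexLSC φ) {u w : ℝ} (hu : φ u ≠ ⊤) (hw : φ w ≠ ⊤) {t : ℝ}
    (ht0 : 0 ≤ t) (ht1 : t ≤ 1) :
    φ (u + t * (w - u)) ≤ (((1 - t) * (φ u).toReal + t * (φ w).toReal : ℝ) : EReal) := by
  have h := hφ.convex_epigraph (x := (u, (φ u).toReal)) (y := (w, (φ w).toReal))
    (EReal.coe_toReal hu (hφ.ne_bot u)).ge (EReal.coe_toReal hw (hφ.ne_bot w)).ge
    (sub_nonneg.2 ht1) ht0 (by ring)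
  simp only [Set.mem_ofPred_eq, Prod.smul_mk, Prod.mk_add_mk, smul_eq_mul] at h
  convert h using 2
  ring

/-- Compare u with u + t (w - u): convexity bounds φ there, the quadratic contributes a term linear
in t plus O(t²), and dividing by t and letting t → 0 gives the subgradient inequality. -/
theorem isSubgradient_of_isProx (hφ : IsProperConvexLSC φ) {τ v u : ℝ} (hτ : 0 < τ)
    (h : IsProx τ φ v u) : IsSubgradient φ u ((v - u) / τ) := by
  have hu : φ u ≠ ⊤ := by
    obtain ⟨t, ht⟩ := hφ.exists_ne_top
    intro hu
    have h1 := h t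
    rw [hu, EReal.top_add_coe, top_le_iff, ← EReal.coe_toReal ht (hφ.ne_bot t),
      ← EReal.coe_add] at h1
    exact EReal.coe_ne_top _ h1
  refine ⟨hu, fun w => ?_⟩
  by_cases hw : φ w = ⊤
  · rw [hw]; exact le_top
  set a := (φ u).toReal
  set b := (φ w).toReal
  have key : ∀ t : ℝ, 0 < t → t ≤ 1 →
      a + (v - u) / τ * (w - u) ≤ b + t * ((w - u) ^ 2 / (2 * τ)) := by
    intro t ht0 ht1
    have h1 := (h (u + t * (w - u))).trans
      (add_le_add_left (hφ.le_combo hu hw ht0.le ht1) _)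
    rw [← EReal.coe_toReal hu (hφ.ne_bot u), ← EReal.coe_add, ← EReal.coe_add,
      EReal.coe_le_coe_iff] at h1
    have h2 : t * (a + (v - u) / τ * (w - u)) ≤ t * (b + t * ((w - u) ^ 2 / (2 * τ))) := by
      have e : (u + t * (w - u) - v) ^ 2 / (2 * τ) = (u - v) ^ 2 / (2 * τ)
          - t * ((v - u) / τ * (w - u)) + t * (t * ((w - u) ^ 2 / (2 * τ))) := by
        field_simp; ring
      rw [e] at h1
      change a + _ ≤ (1 - t) * a + t * b + _ at h1
      linarith
    exact le_of_mul_le_mul_left h2 ht0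
  have lim : a + (v - u) / τ * (w - u) ≤ b := by
    have hT : Filter.Tendsto (fun t : ℝ => b + t * ((w - u) ^ 2 / (2 * τ)))
        (nhdsWithin 0 (Set.Ioi 0)) (nhds (b + 0 * ((w - u) ^ 2 / (2 * τ)))) := by
      refine Filter.Tendsto.mono_left (Continuous.tendsto ?_ 0) nhdsWithin_le_nhds
      fun_prop
    rw [zero_mul, add_zero] at hT
    refine ge_of_tendsto hT ?_
    filter_upwards [Ioc_mem_nhdsGT (zero_lt_one' ℝ)] with t ht using key t ht.1 ht.2
  rw [← EReal.coe_toReal hu (hφ.ne_bot u), ← EReal.coe_toReal hw (hφ.ne_bot w)]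
  exact_mod_cast lim

/-- The subgradient at t gives an affine minorant, so beyond the radius R the objective is at least
its value at t. A minimizer on the compact ball, which exists by lower semicontinuity, is therefore
global. -/
theorem exists_isProx (hφ : IsProperConvexLSC φ) {t a : ℝ} (ht : IsSubgradient φ t a) {τ : ℝ}
    (hτ : 0 < τ) (v : ℝ) : ∃ u, IsProx τ φ v u := by
  set h : ℝ → EReal := fun w => φ w + (((w - v) ^ 2 / (2 * τ) : ℝ) : EReal)
  have hlsc : LowerSemicontinuous h := by
    refine hφ.lsc.add' (Continuous.lowerSemicontinuous ?_) fun x => ?_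
    · exact continuous_coe_real_ereal.comp (by fun_prop)
    · exact EReal.continuousAt_add (Or.inr (EReal.coe_ne_bot _)) (Or.inr (EReal.coe_ne_top _))
  set R := |2 * (t - v) + 2 * τ * a|
  obtain ⟨u, -, hu⟩ := LowerSemicontinuousOn.exists_isMinOn (s := Metric.closedBall t R)
    ⟨t, Metric.mem_closedBall_self (abs_nonneg _)⟩ (isCompact_closedBall t R)
    (hlsc.lowerSemicontinuousOn _)
  refine ⟨u, fun w => ?_⟩
  by_cases hw : w ∈ Metric.closedBall t R
  · exact hu hw
  refine (hu (Metric.mem_closedBall_self (abs_nonneg _))).trans ?_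
  change φ t + _ ≤ φ w + _
  refine le_trans ?_ (add_le_add_left (ht.2 w) _)
  rw [← EReal.coe_toReal ht.1 (hφ.ne_bot t), ← EReal.coe_add, ← EReal.coe_add, ← EReal.coe_add,
    EReal.coe_le_coe_iff]
  have hw' : R < |w - t| := by
    rwa [Metric.mem_closedBall, Real.dist_eq, not_le] at hw
  have h1 : 0 ≤ (w - t) * ((w - t) + (2 * (t - v) + 2 * τ * a)) := by
    have h2 : -((w - t) * (2 * (t - v) + 2 * τ * a)) ≤ |w - t| * R := by
      rw [← abs_mul]; exact neg_le_abs _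
    have h3 : |w - t| * R ≤ |w - t| * |w - t| :=
      mul_le_mul_of_nonneg_left hw'.le (abs_nonneg _)
    rw [abs_mul_abs_self] at h3
    linarith
  have h4 : a * (w - t) + (w - v) ^ 2 / (2 * τ) - (t - v) ^ 2 / (2 * τ)
      = (w - t) * ((w - t) + (2 * (t - v) + 2 * τ * a)) / (2 * τ) := by
    field_simp; ring
  have h5 := div_nonneg h1 (by positivity : 0 ≤ 2 * τ)
  linarith

theorem isSubgradient_prox (hφ : IsProperConvexLSC φ) {t a : ℝ} (ht : IsSubgradient φ t a)
    {τ : ℝ} (hτ : 0 < τ) (v : ℝ) : IsSubgradient φ (prox τ φ v) ((v - prox τ φ v) / τ) :=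
  hφ.isSubgradient_of_isProx hτ (Classical.epsilon_spec (hφ.exists_isProx ht hτ v))

/-- Monotonicity of the subdifferential, tested at the two prox points. The step is allowed to vary
along with the argument because s may be random: measurability then needs joint continuity. -/
theorem abs_prox_sub_prox_le (hφ : IsProperConvexLSC φ) {t a : ℝ} (ht : IsSubgradient φ t a)
    {τ τ' : ℝ} (hτ : 0 < τ) (hτ' : 0 < τ') (v v' : ℝ) :
    |prox τ φ v - prox τ' φ v'| ≤ |v - v'| + |v' - prox τ' φ v'| * |1 - τ / τ'| := by
  set u := prox τ φ v
  set u' := prox τ' φ v'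
  have h := (hφ.isSubgradient_prox ht hτ' v').mul_sub_nonneg (hφ.isSubgradient_prox ht hτ v)
    hφ.ne_bot
  change 0 ≤ ((v - u) / τ - (v' - u') / τ') * (u - u') at h
  have h1 : 0 ≤ τ * (((v - u) / τ - (v' - u') / τ') * (u - u')) := mul_nonneg hτ.le h
  have e : τ * (((v - u) / τ - (v' - u') / τ') * (u - u'))
      = ((v - v') + (v' - u') * (1 - τ / τ')) * (u - u') - (u - u') ^ 2 := by
    field_simp; ring
  rw [e] at h1
  have h2 : |u - u'| * |u - u'| ≤ (|v - v'| + |v' - u'| * |1 - τ / τ'|) * |u - u'| := by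
    rw [abs_mul_abs_self]
    have h3 := le_abs_self (((v - v') + (v' - u') * (1 - τ / τ')) * (u - u'))
    rw [abs_mul] at h3
    have h4 : |(v - v') + (v' - u') * (1 - τ / τ')| ≤ |v - v'| + |v' - u'| * |1 - τ / τ'| := by
      rw [← abs_mul]; exact abs_add_le _ _
    have h5 := mul_le_mul_of_nonneg_right h4 (abs_nonneg (u - u'))
    linarith
  rcases (abs_nonneg (u - u')).eq_or_lt with h0 | h0
  · rw [← h0]; positivity
  · exact le_of_mul_le_mul_right h2 h0

theorem continuous_prox (hφ : IsProperConvexLSC φ) {t a : ℝ} (ht : IsSubgradient φ t a) :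
    Continuous fun q : Set.Ioi (0 : ℝ) × ℝ => prox q.1 φ q.2 := by
  rw [continuous_iff_continuousAt]
  intro q'
  rw [ContinuousAt, tendsto_iff_dist_tendsto_zero]
  have hT : Filter.Tendsto (fun q : Set.Ioi (0 : ℝ) × ℝ => |q.2 - q'.2|
      + |q'.2 - prox q'.1 φ q'.2| * |1 - (q.1 : ℝ) / q'.1|) (nhds q') (nhds 0) := by
    have : Continuous (fun q : Set.Ioi (0 : ℝ) × ℝ => |q.2 - q'.2|
      + |q'.2 - prox q'.1 φ q'.2| * |1 - (q.1 : ℝ) / q'.1|) := by fun_prop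
    have h := this.tendsto q'
    rwa [sub_self, div_self (ne_of_gt q'.1.2), sub_self, abs_zero, mul_zero, add_zero] at h
  exact squeeze_zero (fun _ => dist_nonneg)
    (fun q => hφ.abs_prox_sub_prox_le ht q.1.2 q'.1.2 q.2 q'.2) hT

theorem measurable_prox (hφ : IsProperConvexLSC φ) {t a : ℝ} (ht : IsSubgradient φ t a)
    {Ω : Type*} [MeasurableSpace Ω] {τ v : Ω → ℝ} (hτ : Measurable τ) (hpos : ∀ ω, 0 < τ ω)
    (hv : Measurable v) : Measurable fun ω => prox (τ ω) φ (v ω) := by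
  have h1 : Measurable fun ω => ((⟨τ ω, hpos ω⟩ : Set.Ioi (0 : ℝ)), v ω) :=
    Measurable.prodMk (Measurable.subtype_mk hτ) hv
  have h2 := (hφ.continuous_prox ht).measurable.comp h1
  exact h2

/-- A supremum of affine functions is convex and lower semicontinuous. Finiteness somewhere is
assumed; in the application a saddle point provides it. -/
theorem fenchelConj (hφ : IsProperConvexLSC φ) (h : ∃ v, fenchelConj φ v ≠ ⊤) :
    IsProperConvexLSC (fenchelConj φ) where
  ne_bot v := by
    obtain ⟨t, ht⟩ := hφ.exists_ne_top
    have h1 : ((t * v : ℝ) : EReal) - φ t ≤ _root_.fenchelConj φ v :=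
      le_iSup (fun t : ℝ => ((t * v : ℝ) : EReal) - φ t) t
    rw [← EReal.coe_toReal ht (hφ.ne_bot t), ← EReal.coe_sub] at h1
    exact ne_bot_of_le_ne_bot (EReal.coe_ne_bot _) h1
  exists_ne_top := h
  convex_epigraph := by
    have e : {q : ℝ × ℝ | _root_.fenchelConj φ q.1 ≤ (q.2 : EReal)}
        = ⋂ t : {t // φ t ≠ ⊤}, {q : ℝ × ℝ | t.1 * q.1 - (φ t.1).toReal ≤ q.2} := by
      ext q
      simp only [Set.mem_ofPred_eq, Set.mem_iInter, _root_.fenchelConj, iSup_le_iff]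
      constructor
      · intro h t
        have h1 := h t.1
        rw [← EReal.coe_toReal t.2 (hφ.ne_bot t.1), ← EReal.coe_sub, EReal.coe_le_coe_iff] at h1
        exact h1
      · intro h t
        by_cases ht : φ t = ⊤
        · rw [ht, EReal.sub_top]; exact bot_le
        · rw [← EReal.coe_toReal ht (hφ.ne_bot t), ← EReal.coe_sub, EReal.coe_le_coe_iff]
          exact h ⟨t, ht⟩
    rw [e]
    refine convex_iInter fun t => ?_
    intro x hx y hy α β hα hβ hαβ
    simp only [Set.mem_ofPred_eq, Prod.fst_add, Prod.snd_add, Prod.smul_fst, Prod.smul_snd,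
      smul_eq_mul] at *
    have h1 := mul_le_mul_of_nonneg_left hx hα
    have h2 := mul_le_mul_of_nonneg_left hy hβ
    have h3 : (φ t.1).toReal = (α + β) * (φ t.1).toReal := by rw [hαβ, one_mul]
    rw [h3]
    linarith
  lsc := by
    refine lowerSemicontinuous_iSup fun t => Continuous.lowerSemicontinuous ?_
    by_cases ht : φ t = ⊤
    · simp only [ht, EReal.sub_top]; exact continuous_const
    · rw [← EReal.coe_toReal ht (hφ.ne_bot t)]
      simp only [← EReal.coe_sub]
      exact continuous_coe_real_ereal.comp (by fun_prop)

end IsProperConvexLSC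

/-! ### First-order inequalities for the smooth term. -/

namespace CompositeProblem

variable {n m : ℕ} (P : CompositeProblem n m)

theorem fderiv_f₂_apply (x h : Fin n → ℝ) :
    fderiv ℝ P.f₂ x h = ∑ i, P.grad₂ x i * h i := by
  conv_lhs => rw [pi_eq_sum_univ' h, map_sum]
  refine Finset.sum_congr rfl fun i _ => ?_
  rw [map_smul, smul_eq_mul, mul_comm, grad₂]

theorem f₂_gradient_le (x x' : Fin n → ℝ) :
    P.f₂ x + ∑ i, P.grad₂ x i * (x' i - x i) ≤ P.f₂ x' := by
  set ψ : ℝ → ℝ := P.f₂ ∘ AffineMap.lineMap x x'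
  have hconv : ConvexOn ℝ Set.univ ψ := by
    simpa using P.f₂_convex.comp_affineMap (AffineMap.lineMap x x' : ℝ →ᵃ[ℝ] (Fin n → ℝ))
  have hd : HasDerivAt ψ (fderiv ℝ P.f₂ x (x' - x)) 0 := by
    have h1 : HasDerivAt (AffineMap.lineMap x x' : ℝ → (Fin n → ℝ)) (x' - x) 0 :=
      AffineMap.hasDerivAt_lineMap
    have h2 : HasFDerivAt P.f₂ (fderiv ℝ P.f₂ x) (AffineMap.lineMap x x' (0 : ℝ)) := by
      rw [AffineMap.lineMap_apply_zero]; exact (P.f₂_diff x).hasFDerivAt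
    exact h2.comp_hasDerivAt 0 h1
  have h := hconv.le_slope_of_hasDerivAt (Set.mem_univ 0) (Set.mem_univ 1) one_pos hd
  rw [fderiv_f₂_apply] at h
  simp only [slope, ψ, Function.comp, AffineMap.lineMap_apply_zero, AffineMap.lineMap_apply_one,
    sub_zero, inv_one, one_smul, vsub_eq_sub, Pi.sub_apply] at h
  linarith

/-- Coordinate descent lemma: along the segment, f₂ minus its claimed quadratic upper model has
nonpositive derivative by the Lipschitz bound. -/
theorem f₂_add_single_le (x : Fin n → ℝ) (i : Fin n) (t : ℝ) :
    P.f₂ (x + Pi.single i t) ≤ P.f₂ x + P.grad₂ x i * t + P.L i / 2 * t ^ 2 := by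
  set ψ : ℝ → ℝ := fun r =>
    P.f₂ (x + Pi.single i (r * t)) - r * (P.grad₂ x i * t) - r ^ 2 * (P.L i / 2 * t ^ 2)
  have hs : ∀ r : ℝ, x + Pi.single i (r * t) = x + r • (t • Pi.single i (1 : ℝ)) := by
    intro r
    rw [← Pi.single_smul, ← Pi.single_smul]
    simp
  have hd : ∀ r, HasDerivAt ψ (P.grad₂ (x + Pi.single i (r * t)) i * t - P.grad₂ x i * t
      - 2 * r * (P.L i / 2 * t ^ 2)) r := by
    intro r
    have h1 : HasDerivAt (fun r : ℝ => x + Pi.single i (r * t))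
        (t • Pi.single i (1 : ℝ) : Fin n → ℝ) r := by
      simp only [hs]
      simpa using ((hasDerivAt_id r).smul_const (t • Pi.single i (1 : ℝ) : Fin n → ℝ)).const_add x
    have h2 := (P.f₂_diff (x + Pi.single i (r * t))).hasFDerivAt.comp_hasDerivAt r h1
    rw [map_smul, smul_eq_mul, mul_comm] at h2
    have h3 := (hasDerivAt_id r).mul_const (P.grad₂ x i * t)
    have h4 := ((hasDerivAt_id r).pow 2).mul_const (P.L i / 2 * t ^ 2)
    refine HasDerivAt.congr_deriv ((h2.sub h3).sub h4) ?_
    simp [grad₂]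
  have hanti : AntitoneOn ψ (Set.Icc 0 1) := by
    refine antitoneOn_of_deriv_nonpos (convex_Icc 0 1)
      (fun r _ => (hd r).continuousAt.continuousWithinAt)
      (fun r _ => (hd r).differentiableAt.differentiableWithinAt) fun r hr => ?_
    rw [interior_Icc] at hr
    rw [(hd r).deriv]
    have h1 := P.f₂_lip i x (r * t)
    have h2 : (P.grad₂ (x + Pi.single i (r * t)) i - P.grad₂ x i) * t ≤ P.L i * |r * t| * |t| := by
      refine (le_abs_self _).trans ?_
      rw [abs_mul]
      exact mul_le_mul_of_nonneg_right h1 (abs_nonneg t)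
    rw [abs_mul, abs_of_pos hr.1, mul_assoc, mul_assoc, abs_mul_abs_self] at h2
    linarith
  have h := hanti (Set.left_mem_Icc.2 zero_le_one) (Set.right_mem_Icc.2 zero_le_one) zero_le_one
  simp only [ψ, one_mul, zero_mul, Pi.single_zero, add_zero] at h
  linarith

theorem f₂_update_le (x : Fin n → ℝ) (i : Fin n) (u : ℝ) :
    P.f₂ (Function.update x i u)
      ≤ P.f₂ x + P.grad₂ x i * (u - x i) + P.L i / 2 * (u - x i) ^ 2 := by
  have h := P.f₂_add_single_le x i (u - x i)
  have e : x + Pi.single i (u - x i) = Function.update x i u := by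
    ext j
    by_cases hj : j = i
    · subst hj; simp
    · simp [hj]
  rwa [e] at h

end CompositeProblem

/-! ### Mean decrease in one step, for abstract data. -/

/-- The mean of a separable sum after updating one coordinate drawn with law `p`. -/
theorem sum_mul_sum_update {ι : Type*} [Fintype ι] [DecidableEq ι] {p : ι → ℝ}
    (hp : ∑ i, p i = 1) (x u : ι → ℝ) (h : ι → ℝ → ℝ) :
    ∑ k, p k * ∑ i, h i (Function.update x k (u k) i)
      = ∑ i, h i (x i) + ∑ i, p i * (h i (u i) - h i (x i)) := by
  have e : ∀ k, ∑ i, h i (Function.update x k (u k) i)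
      = ∑ i, h i (x i) + (h k (u k) - h k (x k)) := by
    intro k
    rw [← Finset.add_sum_erase _ _ (Finset.mem_univ k),
      ← Finset.add_sum_erase _ (fun i => h i (x i)) (Finset.mem_univ k),
      Finset.sum_congr rfl fun i hi => by
        rw [Function.update_of_ne (Finset.ne_of_mem_erase hi)], Function.update_self]
    ring
  simp only [e, mul_add, Finset.sum_add_distrib, ← Finset.sum_mul, hp, one_mul]

/-- Adding q times the prox inequality at xs and p - q times the one at x produces a (p (xb - x) + q
(x - xs)), which matches the terms in a coming from the dual side. Polarization leaves -(2p -
q)/(2τ) · (xb - x)², which explains the factor 2 - q/p in the step size. -/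
theorem primal_coordinate_le {p q τ L Kc γ gr a b x xs xb fx fs fb : ℝ}
    (hq : 0 < q) (hqp : q ≤ p) (hγ0 : 0 < γ) (hγ1 : γ < 1) (hτ : 0 < τ) (hL : 0 ≤ L)
    (hτK : τ * (L + Kc) = γ * (2 - q / p))
    (hfs : fb + (x - τ * (gr + a) - xb) / τ * (xs - xb) ≤ fs)
    (hfx : fb + (x - τ * (gr + a) - xb) / τ * (x - xb) ≤ fx) :
    p * (fb - fx) + p * (gr * (xb - x) + L / 2 * (xb - x) ^ 2) + p * (b * (xb - x))
      + q / 2 * (τ⁻¹ * ((xb - xs) ^ 2 - (x - xs) ^ 2)) + q * ((x - xs) * (a - b))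
      + p * ((xb - x) * (a - b)) + p * (Kc / 2 * (xb - x) ^ 2)
      + p * ((1 - γ) / 4 * Kc * (xb - x) ^ 2)
      + q * ((fx - fs) + gr * (x - xs) + b * (x - xs)) ≤ 0 := by
  have hp : 0 < p := hq.trans_le hqp
  have hr : 0 < τ⁻¹ := inv_pos.2 hτ
  have e : (x - τ * (gr + a) - xb) / τ = (x - xb) * τ⁻¹ - (gr + a) := by
    field_simp; ring
  rw [e] at hfs hfx
  have hK : p * (L + Kc) = γ * (2 * p - q) * τ⁻¹ := by
    have : τ * (p * (L + Kc)) = γ * (2 * p - q) := by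
      calc τ * (p * (L + Kc)) = p * (τ * (L + Kc)) := by ring
        _ = γ * (2 * p - q) := by rw [hτK]; field_simp
    rw [← this]; field_simp
  generalize τ⁻¹ = r at *
  have h1 := mul_le_mul_of_nonneg_left hfs hq.le
  have h2 := mul_le_mul_of_nonneg_left hfx (sub_nonneg.2 hqp)
  have h3 : p * Kc ≤ γ * (2 * p - q) * r := by
    rw [← hK, mul_add]; linarith [mul_nonneg hp.le hL]
  -- The slack: the step size uses only a fraction γ of the available quadratic term, which leaves
  -- room for the extra multiple (1 - γ)/4 of Kc.
  have h4 : p * (L + Kc) / 2 + (1 - γ) / 4 * (p * Kc) ≤ (2 * p - q) * r / 2 := by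
    have h5 : (1 - γ) / 4 * (p * Kc) ≤ (1 - γ) / 4 * (γ * (2 * p - q) * r) :=
      mul_le_mul_of_nonneg_left h3 (by linarith)
    have h6 : 0 ≤ (1 - γ) * (1 - γ / 2) * ((2 * p - q) * r) :=
      mul_nonneg (mul_nonneg (by linarith) (by linarith)) (mul_nonneg (by linarith) hr.le)
    rw [hK]; linarith
  have h7 := mul_le_mul_of_nonneg_right h4 (sq_nonneg (xb - x))
  linarith

theorem dual_coordinate_le {q σ y ys yb u us : ℝ} (hq : 0 < q) (hσ : 0 < σ)
    (hy : 0 ≤ ((y + σ * u - yb) / σ - us) * (yb - ys)) :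
    q / 2 * (σ⁻¹ * ((yb - ys) ^ 2 - (y - ys) ^ 2)) ≤ q * ((u - us) * (yb - ys)) := by
  have e : (y + σ * u - yb) / σ = (y - yb) * σ⁻¹ + u := by field_simp; ring
  rw [e] at hy
  have hr : 0 < σ⁻¹ := inv_pos.2 hσ
  have h1 := mul_nonneg hq.le hy
  have h2 := mul_nonneg (mul_nonneg hq.le hr.le) (sq_nonneg (y - yb))
  linarith

theorem sum_mul_sum_ite {ι κ : Type*} [Fintype ι] [Fintype κ] {p : ι → ℝ}
    (hp : ∑ i, p i = 1) (A : Matrix κ ι ℝ) (a : ι → κ → ℝ) (b : κ → ℝ) :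
    ∑ k, p k * ∑ j, (if A j k ≠ 0 then a k j else b j)
      = ∑ j, b j + ∑ k, p k * ∑ j, (if A j k ≠ 0 then a k j - b j else 0) := by
  have e : ∀ k, ∑ j, (if A j k ≠ 0 then a k j else b j)
      = ∑ j, b j + ∑ j, (if A j k ≠ 0 then a k j - b j else 0) := by
    intro k
    rw [← Finset.sum_add_distrib]
    refine Finset.sum_congr rfl fun j _ => ?_
    split_ifs <;> ring
  simp only [e, mul_add, Finset.sum_add_distrib, ← Finset.sum_mul, hp, one_mul]

section OneStep

variable {ι κ : Type*} [Fintype ι] [Fintype κ]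

/-- The weights are all (K q)⁻¹. Expanding the square on refreshed rows yields the cross term and
the quadratic term in δ; both carry a factor A j k, so they may be summed over all rows. Positivity
of K is required only when a row exists, since K degenerates to 0 for an empty matrix. -/
theorem dual_mean_eq {p δ : ι → ℝ} {A : Matrix κ ι ℝ} {σ y ys yb : κ → ℝ} {K q : ℝ}
    (hp1 : ∑ i, p i = 1) (hq : 0 < q) (hK : κ → 0 < K)
    (hσK : ∀ j, σ j * ∑ i with A j i ≠ 0, p i = K * q) :
    q / 2 * ∑ k, p k * ∑ j, (∑ i with A j i ≠ 0, p i)⁻¹ * (σ j)⁻¹ *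
        ((if A j k ≠ 0 then yb j + K * (A j k * δ k) else y j) - ys j) ^ 2
      = q / 2 * ∑ j, (∑ i with A j i ≠ 0, p i)⁻¹ * (σ j)⁻¹ * (y j - ys j) ^ 2
        + ∑ j, q / 2 * ((σ j)⁻¹ * ((yb j - ys j) ^ 2 - (y j - ys j) ^ 2))
        + ∑ k, p k * (δ k * ((∑ j, A j k * yb j) - ∑ j, A j k * ys j))
        + ∑ k, p k * ((K * ∑ j, A j k ^ 2) / 2 * δ k ^ 2) := by
  have hw : ∀ j, (∑ i with A j i ≠ 0, p i)⁻¹ * (σ j)⁻¹ = (K * q)⁻¹ := by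
    intro j; rw [← hσK j, mul_inv, mul_comm]
  have hπ : ∀ j, (K * q)⁻¹ * ∑ i with A j i ≠ 0, p i = (σ j)⁻¹ := by
    intro j
    have h2 : ∑ i with A j i ≠ 0, p i ≠ 0 := by
      intro h
      have := hσK j
      rw [h, mul_zero] at this
      exact (mul_pos (hK j) hq).ne this
    rw [← hσK j, mul_inv, inv_mul_cancel_right₀ h2]
  have e1 : ∀ k j, (∑ i with A j i ≠ 0, p i)⁻¹ * (σ j)⁻¹ *
        ((if A j k ≠ 0 then yb j + K * (A j k * δ k) else y j) - ys j) ^ 2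
      = if A j k ≠ 0 then (K * q)⁻¹ * (yb j + K * (A j k * δ k) - ys j) ^ 2
          else (K * q)⁻¹ * (y j - ys j) ^ 2 := by
    intro k j; rw [hw]; split_ifs <;> rfl
  simp only [e1]
  rw [sum_mul_sum_ite hp1]
  have e2 : ∀ k, ∑ j, (if A j k ≠ 0 then (K * q)⁻¹ * (yb j + K * (A j k * δ k) - ys j) ^ 2
          - (K * q)⁻¹ * (y j - ys j) ^ 2 else 0)
      = ∑ j, (if A j k ≠ 0 then (K * q)⁻¹ * ((yb j - ys j) ^ 2 - (y j - ys j) ^ 2) else 0)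
        + 2 / q * (δ k * ((∑ j, A j k * yb j) - ∑ j, A j k * ys j))
        + 2 / q * ((K * ∑ j, A j k ^ 2) / 2 * δ k ^ 2) := by
    intro k
    rw [← Finset.sum_sub_distrib, Finset.mul_sum, Finset.mul_sum, Finset.mul_sum,
      Finset.sum_div, Finset.sum_mul, Finset.mul_sum, ← Finset.sum_add_distrib,
      ← Finset.sum_add_distrib]
    refine Finset.sum_congr rfl fun j _ => ?_
    have hK' := hK j
    split_ifs with h
    · field_simp; ring
    · rw [not_not] at h; rw [h]; ring
  -- Exchanging the sums, row j is met with total probability π_j, which cancels its inverse in the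
  -- weight.
  have e3 : ∑ k, p k * ∑ j,
        (if A j k ≠ 0 then (K * q)⁻¹ * ((yb j - ys j) ^ 2 - (y j - ys j) ^ 2) else 0)
      = ∑ j, (σ j)⁻¹ * ((yb j - ys j) ^ 2 - (y j - ys j) ^ 2) := by
    simp only [Finset.mul_sum]
    rw [Finset.sum_comm]
    refine Finset.sum_congr rfl fun j _ => ?_
    rw [← hπ j, Finset.mul_sum, Finset.sum_filter, Finset.sum_mul]
    refine Finset.sum_congr rfl fun k _ => ?_
    split_ifs <;> ring
  simp only [e2, mul_add, Finset.sum_add_distrib, e3, hw]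
  have e4 : ∀ (g : ι → ℝ), q / 2 * ∑ k, p k * (2 / q * g k) = ∑ k, p k * g k := by
    intro g
    rw [Finset.mul_sum]
    refine Finset.sum_congr rfl fun k _ => ?_
    field_simp
  rw [e4 fun k => δ k * ((∑ j, A j k * yb j) - ∑ j, A j k * ys j),
    e4 fun k => (K * ∑ j, A j k ^ 2) / 2 * δ k ^ 2,
    ← Finset.mul_sum Finset.univ (fun j => (σ j)⁻¹ * ((yb j - ys j) ^ 2 - (y j - ys j) ^ 2)) (q / 2)]
  simp only [add_assoc]

/-- On refreshed rows the old error is replaced by the extrapolation K A δ; keeping the old error in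
the bound there as well only loses a nonnegative term. -/
theorem error_mean_le {p δ : ι → ℝ} {A : Matrix κ ι ℝ} {σ e : κ → ℝ} {K q : ℝ}
    (hp : ∀ i, 0 < p i)
    (hp1 : ∑ i, p i = 1) (hq : 0 < q) (hK : κ → 0 < K)
    (hσK : ∀ j, σ j * ∑ i with A j i ≠ 0, p i = K * q) :
    q * ∑ k, p k * ∑ j, (∑ i with A j i ≠ 0, p i)⁻¹ * (σ j)⁻¹ *
        (if A j k ≠ 0 then K * (A j k * δ k) else e j) ^ 2
      ≤ q * ∑ j, (∑ i with A j i ≠ 0, p i)⁻¹ * (σ j)⁻¹ * e j ^ 2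
        + ∑ k, p k * ((K * ∑ j, A j k ^ 2) * δ k ^ 2) := by
  have hw : ∀ j, (∑ i with A j i ≠ 0, p i)⁻¹ * (σ j)⁻¹ = (K * q)⁻¹ := by
    intro j; rw [← hσK j, mul_inv, mul_comm]
  simp only [hw]
  have h : ∀ k, q * ∑ j, (K * q)⁻¹ * (if A j k ≠ 0 then K * (A j k * δ k) else e j) ^ 2
      ≤ q * ∑ j, (K * q)⁻¹ * e j ^ 2 + (K * ∑ j, A j k ^ 2) * δ k ^ 2 := by
    intro k
    rw [Finset.mul_sum, Finset.mul_sum, Finset.mul_sum, Finset.sum_mul, ← Finset.sum_add_distrib]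
    refine Finset.sum_le_sum fun j _ => ?_
    have hK' := hK j
    split_ifs with h
    · have e1 : q * ((K * q)⁻¹ * (K * (A j k * δ k)) ^ 2) = K * A j k ^ 2 * δ k ^ 2 := by
        field_simp
      rw [e1]
      have : 0 ≤ q * ((K * q)⁻¹ * e j ^ 2) := by positivity
      linarith
    · have : 0 ≤ K * A j k ^ 2 * δ k ^ 2 := by positivity
      linarith
  calc _ = ∑ k, p k * (q * ∑ j, (K * q)⁻¹ *
        (if A j k ≠ 0 then K * (A j k * δ k) else e j) ^ 2) := by
        rw [Finset.mul_sum]; exact Finset.sum_congr rfl fun k _ => by ring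
    _ ≤ ∑ k, p k * (q * ∑ j, (K * q)⁻¹ * e j ^ 2 + (K * ∑ j, A j k ^ 2) * δ k ^ 2) :=
        Finset.sum_le_sum fun k _ => mul_le_mul_of_nonneg_left (h k) (hp k).le
    _ = _ := by simp only [mul_add, Finset.sum_add_distrib, ← Finset.sum_mul, hp1, one_mul]

/-- One step of the method does not increase the mean of the Lyapunov function, which adds to the
weighted distance a multiple of the squared gap `e` between the two dual sequences. -/
theorem lyapunov_mean_le [DecidableEq ι]
    {p τ L gr x xs xb fx fs fb : ι → ℝ} {A : Matrix κ ι ℝ} {σ y ys yb e : κ → ℝ}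
    {K q γ : ℝ} {F : (ι → ℝ) → ℝ}
    (hp : ∀ i, 0 < p i) (hp1 : ∑ i, p i = 1) (hq : 0 < q) (hqp : ∀ i, q ≤ p i)
    (hγ0 : 0 < γ) (hγ1 : γ < 1) (hτ : ∀ i, 0 < τ i) (hσ : ∀ j, 0 < σ j) (hK : κ → 0 < K)
    (hL : ∀ i, 0 ≤ L i) (hτK : ∀ i, τ i * (L i + K * ∑ j, A j i ^ 2) = γ * (2 - q / p i))
    (hσK : ∀ j, σ j * ∑ i with A j i ≠ 0, p i = K * q)
    (hF : F x + ∑ i, gr i * (xs i - x i) ≤ F xs)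
    (hF' : ∀ i u, F (Function.update x i u) ≤ F x + gr i * (u - x i) + L i / 2 * (u - x i) ^ 2)
    (hfs : ∀ i, fb i + (x i - τ i * (gr i + ∑ j, A j i * yb j) - xb i) / τ i * (xs i - xb i)
      ≤ fs i)
    (hfx : ∀ i, fb i + (x i - τ i * (gr i + ∑ j, A j i * yb j) - xb i) / τ i * (x i - xb i)
      ≤ fx i)
    (hy : ∀ j, 0 ≤ ((y j + σ j * (∑ i, A j i * x i) - yb j) / σ j - ∑ i, A j i * xs i)
      * (yb j - ys j))
    (hD : 0 ≤ ∑ i, fx i - ∑ i, fs i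
      + (F x - F xs + ∑ i, (∑ j, A j i * ys j) * (x i - xs i))) :
    ∑ k, p k * (∑ i, Function.update fx k (fb k) i - ∑ i, fs i
        + (F (Function.update x k (xb k)) - F xs
          + ∑ i, (∑ j, A j i * ys j) * (Function.update x k (xb k) i - xs i))
        + q / 2 * (∑ i, (p i)⁻¹ * (τ i)⁻¹ * (Function.update x k (xb k) i - xs i) ^ 2
          + ∑ j, (∑ i with A j i ≠ 0, p i)⁻¹ * (σ j)⁻¹ *
            ((if A j k ≠ 0 then yb j + K * (A j k * (xb k - x k)) else y j) - ys j) ^ 2)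
        + (1 - γ) / 4 * (q * ∑ j, (∑ i with A j i ≠ 0, p i)⁻¹ * (σ j)⁻¹ *
          (if A j k ≠ 0 then K * (A j k * (xb k - x k)) else e j) ^ 2))
      ≤ ∑ i, fx i - ∑ i, fs i
        + (F x - F xs + ∑ i, (∑ j, A j i * ys j) * (x i - xs i))
        + q / 2 * (∑ i, (p i)⁻¹ * (τ i)⁻¹ * (x i - xs i) ^ 2
          + ∑ j, (∑ i with A j i ≠ 0, p i)⁻¹ * (σ j)⁻¹ * (y j - ys j) ^ 2)
        + (1 - γ) / 4 * (q * ∑ j, (∑ i with A j i ≠ 0, p i)⁻¹ * (σ j)⁻¹ * e j ^ 2) := by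
  have m1 := sum_mul_sum_update hp1 fx fb fun _ t => t
  have m2 : ∑ k, p k * F (Function.update x k (xb k))
      ≤ F x + ∑ k, p k * (gr k * (xb k - x k) + L k / 2 * (xb k - x k) ^ 2) := by
    calc _ ≤ ∑ k, p k * (F x + (gr k * (xb k - x k) + L k / 2 * (xb k - x k) ^ 2)) :=
          Finset.sum_le_sum fun k _ => mul_le_mul_of_nonneg_left
            (by linarith [hF' k (xb k)]) (hp k).le
      _ = _ := by simp only [mul_add, Finset.sum_add_distrib, ← Finset.sum_mul, hp1, one_mul]
  have m3 := sum_mul_sum_update hp1 x xb fun i t => (∑ j, A j i * ys j) * (t - xs i)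
  have m4 := sum_mul_sum_update hp1 x xb fun i t => (p i)⁻¹ * (τ i)⁻¹ * (t - xs i) ^ 2
  have m5 := dual_mean_eq (y := y) (ys := ys) (yb := yb) (δ := fun k => xb k - x k)
    hp1 hq hK hσK
  have m6 := error_mean_le (e := e) (δ := fun k => xb k - x k) hp hp1 hq hK hσK
  -- Monotonicity on the dual side, transposed to the primal coordinates so that it meets the
  -- coupling term of `primal_coordinate_le`.
  have m7 : ∑ j, q / 2 * ((σ j)⁻¹ * ((yb j - ys j) ^ 2 - (y j - ys j) ^ 2))
      ≤ ∑ i, q * ((x i - xs i) * ((∑ j, A j i * yb j) - ∑ j, A j i * ys j)) := by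
    calc _ ≤ ∑ j, q * (((∑ i, A j i * x i) - ∑ i, A j i * xs i) * (yb j - ys j)) :=
          Finset.sum_le_sum fun j _ => dual_coordinate_le hq (hσ j) (hy j)
      _ = _ := by
          simp only [← Finset.sum_sub_distrib, Finset.mul_sum, Finset.sum_mul]
          rw [Finset.sum_comm]
          exact Finset.sum_congr rfl fun i _ => Finset.sum_congr rfl fun j _ => by ring
  have m8 := Finset.sum_nonpos fun i (_ : i ∈ Finset.univ) =>
    primal_coordinate_le (b := ∑ j, A j i * ys j) hq (hqp i) hγ0 hγ1 (hτ i) (hL i) (hτK i)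
      (hfs i) (hfx i)
  simp only [Finset.sum_add_distrib, ← Finset.mul_sum] at m8
  -- With convexity of F in the next line, this shows that the last term of the summed primal
  -- inequality is nonnegative, so it can be dropped.
  have m9 := mul_nonneg hq.le hD
  have m10 := mul_le_mul_of_nonneg_left hF hq.le
  have m11 := mul_le_mul_of_nonneg_left m6 (by linarith : 0 ≤ (1 - γ) / 4)
  have split : ∀ a G c d g h : ι → ℝ, ∀ fS FS t : ℝ,
      ∑ k, p k * (a k - fS + (G k - FS + c k) + q / 2 * (d k + g k) + t * (q * h k))
        = ∑ k, p k * a k - fS + (∑ k, p k * G k - FS + ∑ k, p k * c k)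
          + q / 2 * (∑ k, p k * d k) + q / 2 * (∑ k, p k * g k) + t * (q * ∑ k, p k * h k) := by
    intro a G c d g h fS FS t
    have e : ∀ k, p k * (a k - fS + (G k - FS + c k) + q / 2 * (d k + g k) + t * (q * h k))
        = p k * a k + p k * G k + p k * c k + q / 2 * (p k * d k) + q / 2 * (p k * g k)
          + t * q * (p k * h k) + p k * (-fS - FS) := fun k => by ring
    simp only [e, Finset.sum_add_distrib, ← Finset.mul_sum, ← Finset.sum_mul, hp1]
    ring
  rw [split, m5, m1, m3, m4]
  have m12 : ∑ i, p i * ((p i)⁻¹ * (τ i)⁻¹ * (xb i - xs i) ^ 2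
        - (p i)⁻¹ * (τ i)⁻¹ * (x i - xs i) ^ 2)
      = ∑ i, (τ i)⁻¹ * ((xb i - xs i) ^ 2 - (x i - xs i) ^ 2) :=
    Finset.sum_congr rfl fun i _ => by have := hp i; field_simp
  have m13 : ∑ i, p i * ((∑ j, A j i * ys j) * (xb i - xs i)
        - (∑ j, A j i * ys j) * (x i - xs i))
      = ∑ i, p i * ((∑ j, A j i * ys j) * (xb i - x i)) :=
    Finset.sum_congr rfl fun i _ => by ring
  have m14 : ∑ i, gr i * (xs i - x i) = -∑ i, gr i * (x i - xs i) := by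
    rw [← Finset.sum_neg_distrib]; exact Finset.sum_congr rfl fun i _ => by ring
  have m15 : ∑ i, p i * ((1 - γ) / 4 * (K * ∑ j, A j i ^ 2) * (xb i - x i) ^ 2)
      = (1 - γ) / 4 * ∑ i, p i * ((K * ∑ j, A j i ^ 2) * (xb i - x i) ^ 2) := by
    rw [Finset.mul_sum]; exact Finset.sum_congr rfl fun i _ => by ring
  rw [Finset.sum_sub_distrib] at m8
  rw [m12, m13]
  rw [m14] at m10
  rw [m15] at m8
  simp only [← Finset.mul_sum] at m7 ⊢
  linarith
end OneStep

/-! ### Step-size identities and the Lyapunov function of the method. -/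

namespace CompositeProblem

theorem pMin_le {n : ℕ} (p : Fin n → ℝ) (i : Fin n) : pMin p ≤ p i :=
  ciInf_le (Set.finite_range p).bddBelow i

theorem pMin_pos {n : ℕ} [Nonempty (Fin n)] {p : Fin n → ℝ} (hp : ∀ i, 0 < p i) : 0 < pMin p := by
  obtain ⟨i, hi⟩ := exists_eq_ciInf_of_finite (f := p)
  rw [pMin, ← hi]
  exact hp i

variable {n m : ℕ} (P : CompositeProblem n m)

theorem L_nonneg (i : Fin n) : 0 ≤ P.L i := by
  have h := P.f₂_lip i 0 1
  rw [abs_one, mul_one] at h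
  exact (abs_nonneg _).trans h

section StepSizes

variable {P} {p : Fin n → ℝ} {γ s : ℝ}

theorem piProb_pos (hp : ∀ i, 0 < p i) {j : Fin m} (h : ∃ i, P.A j i ≠ 0) : 0 < P.piProb p j := by
  obtain ⟨i, hi⟩ := h
  exact Finset.sum_pos (fun i _ => hp i) ⟨i, by simpa using hi⟩

theorem colNorm_sq (i : Fin n) : P.colNorm i ^ 2 = ∑ j, P.A j i ^ 2 :=
  Real.sq_sqrt (Finset.sum_nonneg fun _ _ => sq_nonneg _)

theorem colNorm_sq_pos {i : Fin n} (h : ∃ j, P.A j i ≠ 0) : 0 < P.colNorm i ^ 2 := by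
  obtain ⟨j, hj⟩ := h
  rw [colNorm_sq]
  exact Finset.sum_pos' (fun _ _ => sq_nonneg _) ⟨j, Finset.mem_univ j, by positivity⟩

theorem maxColNorm_nonneg : 0 ≤ P.maxColNorm := Real.iSup_nonneg fun _ => Real.sqrt_nonneg _

theorem maxColNorm_pos {i : Fin n} (h : ∃ j, P.A j i ≠ 0) : 0 < P.maxColNorm := by
  have h1 : 0 < P.colNorm i :=
    lt_of_le_of_ne (Real.sqrt_nonneg _) fun h0 => by
      have := colNorm_sq_pos h
      rw [← h0] at this
      norm_num at this
  exact h1.trans_le (le_ciSup (Set.finite_range P.colNorm).bddAbove i)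

theorem theta_pos [Nonempty (Fin n)] (hp : ∀ i, 0 < p i) {j : Fin m} (h : ∃ i, P.A j i ≠ 0) :
    0 < P.theta p j :=
  div_pos (piProb_pos hp h) (pMin_pos hp)

theorem maxColNorm_pos_of_row {j : Fin m} (h : ∃ i, P.A j i ≠ 0) : 0 < P.maxColNorm := by
  obtain ⟨i, hi⟩ := h
  exact maxColNorm_pos ⟨j, hi⟩

theorem sigma_pos [Nonempty (Fin n)] (hp : ∀ i, 0 < p i) {j : Fin m} (h : ∃ i, P.A j i ≠ 0)
    (hs : 0 < s) : 0 < P.sigma p s j :=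
  div_pos hs (mul_pos (theta_pos hp h) (maxColNorm_pos_of_row h))

theorem sigma_mul_theta [Nonempty (Fin n)] (hp : ∀ i, 0 < p i) {j : Fin m}
    (h : ∃ i, P.A j i ≠ 0) : P.sigma p s j * P.theta p j = s / P.maxColNorm := by
  have h1 := theta_pos hp h
  have h2 := maxColNorm_pos_of_row h
  rw [sigma]
  field_simp

theorem sigma_mul_piProb [Nonempty (Fin n)] (hp : ∀ i, 0 < p i) {j : Fin m}
    (h : ∃ i, P.A j i ≠ 0) :
    P.sigma p s j * P.piProb p j = s / P.maxColNorm * pMin p := by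
  have h1 := pMin_pos hp
  rw [← sigma_mul_theta hp h, theta]
  field_simp

theorem tau_denom_pos (hcol : ∀ i, 0 < P.L i ∨ ∃ j, P.A j i ≠ 0) (hs : 0 < s) (i : Fin n) :
    0 < P.L i + s * P.colNorm i ^ 2 / P.maxColNorm := by
  rcases hcol i with h | h
  · exact add_pos_of_pos_of_nonneg h
      (div_nonneg (mul_nonneg hs.le (sq_nonneg _)) maxColNorm_nonneg)
  · exact add_pos_of_nonneg_of_pos (P.L_nonneg i)
      (div_pos (mul_pos hs (colNorm_sq_pos h)) (maxColNorm_pos h))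

theorem tau_pos (hcol : ∀ i, 0 < P.L i ∨ ∃ j, P.A j i ≠ 0) (hp : ∀ i, 0 < p i) (hγ : 0 < γ)
    (hs : 0 < s) (i : Fin n) : 0 < P.tau p γ s i := by
  refine div_pos (mul_pos hγ ?_) (tau_denom_pos hcol hs i)
  have := (div_le_one (hp i)).2 (pMin_le p i)
  linarith

theorem tau_mul_denom (hcol : ∀ i, 0 < P.L i ∨ ∃ j, P.A j i ≠ 0) (hs : 0 < s) (i : Fin n) :
    P.tau p γ s i * (P.L i + s / P.maxColNorm * ∑ j, P.A j i ^ 2) = γ * (2 - pMin p / p i) := by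
  have h := (tau_denom_pos hcol hs i).ne'
  rw [← colNorm_sq, div_mul_eq_mul_div, tau, div_mul_cancel₀ _ h]

end StepSizes

/-- The value of `y̌` after the coordinate `i` has been drawn at `z`. -/
def yCheckNext (p : Fin n → ℝ) (s : ℝ) (z : PrimalDual n m) (yc : Fin m → ℝ) (i : Fin n) :
    Fin m → ℝ :=
  fun j => if P.A j i ≠ 0 then P.yBar p s z j else yc j

/-- The weighted square norm on the dual space. -/
def dualNormSq (p : Fin n → ℝ) (s : ℝ) (y : Fin m → ℝ) : ℝ :=
  ∑ j, (P.piProb p j)⁻¹ * (P.sigma p s j)⁻¹ * y j ^ 2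

/-- The real-valued primal gap, for `x` in the domain of `f`. -/
def primalGapReal (zs : PrimalDual n m) (x : Fin n → ℝ) : ℝ :=
  ∑ i, (P.f i (x i)).toReal - ∑ i, (P.f i (zs.1 i)).toReal
    + (P.f₂ x - P.f₂ zs.1 + ∑ i, (P.Aᵀ *ᵥ zs.2) i * (x i - zs.1 i))

/-- The Lyapunov function: the weighted distance to `zs`, plus a multiple of the squared gap
between `y` and `y̌`. -/
def lyapunov (p : Fin n → ℝ) (γ s : ℝ) (zs z : PrimalDual n m) (yc : Fin m → ℝ) : ℝ :=
  P.primalGapReal zs z.1 + pMin p / 2 * P.wNormSq p γ s (z - zs)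
    + (1 - γ) / 4 * (pMin p * P.dualNormSq p s (z.2 - yc))

variable {P} {p : Fin n → ℝ} {γ s : ℝ} {zs z : PrimalDual n m}

/-- Sum of the subgradient inequalities for the f i and the gradient inequality for f₂, both taken
at the saddle point. -/
theorem IsSaddle.primalGapReal_nonneg (hzs : P.IsSaddle zs) {x : Fin n → ℝ}
    (hx : ∀ i, P.f i (x i) ≠ ⊤) : 0 ≤ P.primalGapReal zs x := by
  have h1 := Finset.sum_le_sum fun i (_ : i ∈ Finset.univ) =>
    (hzs.1 i).toReal_add_le (P.f_proper i).ne_bot (hx i)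
  have h2 := P.f₂_gradient_le zs.1 x
  have e : ∑ i, -(P.grad₂ zs.1 i + (P.Aᵀ *ᵥ zs.2) i) * (x i - zs.1 i)
      = -∑ i, P.grad₂ zs.1 i * (x i - zs.1 i) - ∑ i, (P.Aᵀ *ᵥ zs.2) i * (x i - zs.1 i) := by
    rw [← Finset.sum_neg_distrib, ← Finset.sum_sub_distrib]
    exact Finset.sum_congr rfl fun i _ => by ring
  rw [Finset.sum_add_distrib, e] at h1
  rw [primalGapReal]
  linarith

theorem IsSaddle.conj_proper (hzs : P.IsSaddle zs) (j : Fin m) :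
    IsProperConvexLSC (fenchelConj (P.g j)) :=
  (P.g_proper j).fenchelConj ⟨_, (hzs.2 j).1⟩

theorem IsSaddle.isSubgradient_yBar (hzs : P.IsSaddle zs) {j : Fin m} (hσ : 0 < P.sigma p s j) :
    IsSubgradient (fenchelConj (P.g j)) (P.yBar p s z j)
      ((z.2 j + P.sigma p s j * (P.A *ᵥ z.1) j - P.yBar p s z j) / P.sigma p s j) :=
  (hzs.conj_proper j).isSubgradient_prox (hzs.2 j) hσ _

theorem IsSaddle.isSubgradient_xBar (hzs : P.IsSaddle zs) {i : Fin n} (hτ : 0 < P.tau p γ s i) :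
    IsSubgradient (P.f i) (P.xBar p γ s z i)
      ((z.1 i - P.tau p γ s i * (P.grad₂ z.1 i + (P.Aᵀ *ᵥ P.yBar p s z) i) - P.xBar p γ s z i)
        / P.tau p γ s i) :=
  (P.f_proper i).isSubgradient_prox (hzs.1 i) hτ _

theorem IsSaddle.f_xNext_ne_top (hzs : P.IsSaddle zs) (hτ : ∀ i, 0 < P.tau p γ s i)
    (hz : ∀ i, P.f i (z.1 i) ≠ ⊤) (k i : Fin n) : P.f i (P.xNext p γ s z k i) ≠ ⊤ := by
  by_cases h : i = k
  · subst h
    rw [xNext, Function.update_self]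
    exact (hzs.isSubgradient_xBar (hτ i)).1
  · rw [xNext, Function.update_of_ne h]
    exact hz i

theorem IsSaddle.lyapunov_mean_le (hzs : P.IsSaddle zs)
    (hrow : ∀ j, ∃ i, P.A j i ≠ 0) (hcol : ∀ i, 0 < P.L i ∨ ∃ j, P.A j i ≠ 0)
    (hp : ∀ i, 0 < p i) (hp_sum : ∑ i, p i = 1) (hγ0 : 0 < γ) (hγ1 : γ < 1) (hs : 0 < s)
    (hz : ∀ i, P.f i (z.1 i) ≠ ⊤) (yc : Fin m → ℝ) :
    ∑ k, p k * P.lyapunov p γ s zs (P.xNext p γ s z k, P.yNext p γ s z k)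
        (P.yCheckNext p s z yc k) ≤ P.lyapunov p γ s zs z yc := by
  have : Nonempty (Fin n) := by
    by_contra h
    rw [not_nonempty_iff] at h
    simp at hp_sum
  have hτ := tau_pos (P := P) (s := s) hcol hp hγ0 hs
  have hσ := fun j => sigma_pos hp (hrow j) hs
  have hσθ := fun j => sigma_mul_theta (s := s) hp (hrow j)
  have key := _root_.lyapunov_mean_le (p := p) (τ := P.tau p γ s) (L := P.L) (gr := P.grad₂ z.1)
    (x := z.1) (xs := zs.1) (xb := P.xBar p γ s z) (fx := fun i => (P.f i (z.1 i)).toReal)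
    (fs := fun i => (P.f i (zs.1 i)).toReal) (fb := fun i => (P.f i (P.xBar p γ s z i)).toReal)
    (A := P.A) (σ := P.sigma p s) (y := z.2) (ys := zs.2) (yb := P.yBar p s z)
    (e := fun j => z.2 j - yc j) (K := s / P.maxColNorm) (q := pMin p) (γ := γ) (F := P.f₂)
    hp hp_sum (pMin_pos hp) (pMin_le p) hγ0 hγ1 hτ hσ
    (fun j => div_pos hs (maxColNorm_pos_of_row (hrow j))) P.L_nonneg (tau_mul_denom hcol hs)
    (fun j => sigma_mul_piProb hp (hrow j)) (P.f₂_gradient_le z.1 zs.1) (P.f₂_update_le z.1)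
    (fun i => (hzs.isSubgradient_xBar (hτ i)).toReal_add_le (P.f_proper i).ne_bot (hzs.1 i).1)
    (fun i => (hzs.isSubgradient_xBar (hτ i)).toReal_add_le (P.f_proper i).ne_bot (hz i))
    (fun j => (hzs.2 j).mul_sub_nonneg (hzs.isSubgradient_yBar (hσ j)) (hzs.conj_proper j).ne_bot)
    (hzs.primalGapReal_nonneg hz)
  refine le_trans (le_of_eq (Finset.sum_congr rfl fun k _ => ?_)) key
  have hA : ∀ j, (P.A *ᵥ (P.xNext p γ s z k - z.1)) j
      = P.A j k * (P.xBar p γ s z k - z.1 k) := by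
    intro j
    have : P.xNext p γ s z k - z.1 = Pi.single k (P.xBar p γ s z k - z.1 k) := by
      ext i
      by_cases h : i = k
      · subst h; simp [xNext]
      · simp [xNext, h]
    rw [this, Matrix.mulVec_single]
    simp [mul_comm]
  have hy : ∀ j, P.yNext p γ s z k j = if P.A j k ≠ 0 then
      P.yBar p s z j + s / P.maxColNorm * (P.A j k * (P.xBar p γ s z k - z.1 k)) else z.2 j := by
    intro j
    rw [yNext, hσθ, hA]
  have he : ∀ j, P.yNext p γ s z k j - P.yCheckNext p s z yc k j = if P.A j k ≠ 0 then
      s / P.maxColNorm * (P.A j k * (P.xBar p γ s z k - z.1 k)) else z.2 j - yc j := by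
    intro j
    rw [hy, yCheckNext]
    split_ifs <;> ring
  have hf : ∀ i, (P.f i (P.xNext p γ s z k i)).toReal = Function.update
      (fun i => (P.f i (z.1 i)).toReal) k ((P.f k (P.xBar p γ s z k)).toReal) i := by
    intro i
    by_cases h : i = k
    · subst h; simp [xNext]
    · simp [xNext, h]
  simp only [lyapunov, primalGapReal, wNormSq, dualNormSq, Pi.sub_apply, Prod.fst_sub,
    Prod.snd_sub, he, hf]
  simp only [hy]
  rfl

end CompositeProblem

/-! ### Means over finite words of draws. -/

/-- The infinite word that starts with `w` and continues with the constant letter `a`. -/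
def extendWord {α : Type*} (a : α) {k : ℕ} (w : Fin k → α) (l : ℕ) : α :=
  if h : l < k then w ⟨l, h⟩ else a

theorem extendWord_snoc_of_lt {α : Type*} (a b : α) {k : ℕ} (w : Fin k → α) {l : ℕ} (h : l < k) :
    extendWord a (Fin.snoc w b : Fin (k + 1) → α) l = extendWord a w l := by
  rw [extendWord, extendWord, dif_pos h, dif_pos (h.trans (Nat.lt_succ_self k))]
  simp [Fin.snoc, h]

theorem extendWord_snoc_self {α : Type*} (a b : α) {k : ℕ} (w : Fin k → α) :
    extendWord a (Fin.snoc w b : Fin (k + 1) → α) k = b := by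
  simp [extendWord, Fin.snoc]

/-- The mean of `F` over words of length `k` whose letters are independent with law `p`. -/
def wordMean {α : Type*} [Fintype α] (p : α → ℝ) (k : ℕ) (F : (Fin k → α) → ℝ) : ℝ :=
  ∑ w, (∏ l, p (w l)) * F w

section WordMean

variable {α : Type*} [Fintype α] {p : α → ℝ}

theorem wordMean_succ (k : ℕ) (F : (Fin (k + 1) → α) → ℝ) :
    wordMean p (k + 1) F = wordMean p k fun w => ∑ b, p b * F (Fin.snoc w b) := by
  rw [wordMean, ← (Fin.snocEquiv fun _ : Fin (k + 1) => α).sum_comp, Fintype.sum_prod_type_right,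
    wordMean]
  refine Finset.sum_congr rfl fun w _ => ?_
  rw [Finset.mul_sum]
  refine Finset.sum_congr rfl fun b _ => ?_
  rw [Fin.prod_univ_castSucc]
  simp only [Fin.snocEquiv, Equiv.coe_fn_mk, Fin.snoc_castSucc, Fin.snoc_last, mul_assoc]

theorem wordMean_mono (hp : ∀ a, 0 ≤ p a) {k : ℕ} {F G : (Fin k → α) → ℝ} (h : ∀ w, F w ≤ G w) :
    wordMean p k F ≤ wordMean p k G :=
  Finset.sum_le_sum fun w _ => mul_le_mul_of_nonneg_left (h w) (Finset.prod_nonneg fun _ _ => hp _)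

theorem wordMean_add (k : ℕ) (F G : (Fin k → α) → ℝ) :
    wordMean p k (fun w => F w + G w) = wordMean p k F + wordMean p k G := by
  simp only [wordMean, mul_add, Finset.sum_add_distrib]

theorem wordMean_const_mul (k : ℕ) (c : ℝ) (F : (Fin k → α) → ℝ) :
    wordMean p k (fun w => c * F w) = c * wordMean p k F := by
  simp only [wordMean, Finset.mul_sum]
  exact Finset.sum_congr rfl fun w _ => by ring

theorem wordMean_const (hp : ∑ a, p a = 1) (k : ℕ) (c : ℝ) : wordMean p k (fun _ => c) = c := by
  induction k with
  | zero => simp [wordMean]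
  | succ k ih =>
    rw [wordMean_succ]
    simpa only [← Finset.sum_mul, hp, one_mul] using ih

/-- A term depending only on its first k' letters does not see the later ones, whose probabilities
sum to 1. For the same reason the padding letter a is immaterial. -/
theorem wordMean_sum_init (hp : ∑ a, p a = 1) (a : α) (Q : ℕ → (ℕ → α) → ℝ)
    (hQ : ∀ k d d', (∀ l < k, d l = d' l) → Q k d = Q k d') (k : ℕ) :
    wordMean p k (fun w => ∑ k' ∈ Finset.Icc 1 k, Q k' (extendWord a w))
      = ∑ k' ∈ Finset.Icc 1 k, wordMean p k' fun w => Q k' (extendWord a w) := by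
  induction k with
  | zero => simp [wordMean]
  | succ k ih =>
    simp only [Finset.sum_Icc_succ_top (Nat.le_add_left 1 k), wordMean_add]
    rw [wordMean_succ, ← ih]
    congr 2
    ext w
    calc _ = ∑ b, p b * ∑ k' ∈ Finset.Icc 1 k, Q k' (extendWord a w) := by
          refine Finset.sum_congr rfl fun b _ => ?_
          congr 1
          refine Finset.sum_congr rfl fun k' hk' => hQ _ _ _ fun l hl => ?_
          exact extendWord_snoc_of_lt a b w (hl.trans_le (Finset.mem_Icc.1 hk').2)
      _ = _ := by rw [← Finset.sum_mul, hp, one_mul]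

end WordMean

/-! ### Iterates as functions of the draws, and the mean of the Lyapunov function. -/

namespace CompositeProblem

variable {n m : ℕ} {P : CompositeProblem n m} {p : Fin n → ℝ} {γ s : ℝ}
  {zs z z₀ : PrimalDual n m}

theorem iter_congr {d d' : ℕ → Fin n} {k : ℕ} (h : ∀ l < k, d l = d' l) :
    P.iter p γ s z₀ d k = P.iter p γ s z₀ d' k := by
  induction k with
  | zero => rfl
  | succ k ih =>
    rw [iter, iter, ih fun l hl => h l (hl.trans (Nat.lt_succ_self k)), h k (Nat.lt_succ_self k)]

theorem yCheck_congr {d d' : ℕ → Fin n} {k : ℕ} (h : ∀ l < k, d l = d' l) :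
    P.yCheck p γ s z₀ d k = P.yCheck p γ s z₀ d' k := by
  induction k with
  | zero => rfl
  | succ k ih =>
    have h' : ∀ l < k, d l = d' l := fun l hl => h l (hl.trans (Nat.lt_succ_self k))
    ext j
    simp only [yCheck, ih h', h k (Nat.lt_succ_self k), iter_congr h']

theorem avg_congr {d d' : ℕ → Fin n} {k : ℕ} (h : ∀ l < k, d l = d' l) :
    P.avg p γ s z₀ d k = P.avg p γ s z₀ d' k := by
  rw [avg, avg]
  congr 1
  refine Finset.sum_congr rfl fun k' hk' => ?_
  have h' : ∀ l < k', d l = d' l := fun l hl => h l (hl.trans_le (Finset.mem_Icc.1 hk').2)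
  rw [iter_congr h', yCheck_congr h']

theorem IsSaddle.f_iter_ne_top (hzs : P.IsSaddle zs) (hτ : ∀ i, 0 < P.tau p γ s i)
    (hz₀ : ∀ i, P.f i (z₀.1 i) ≠ ⊤) (d : ℕ → Fin n) (k : ℕ) (i : Fin n) :
    P.f i ((P.iter p γ s z₀ d k).1 i) ≠ ⊤ := by
  induction k generalizing i with
  | zero => exact hz₀ i
  | succ k ih => exact hzs.f_xNext_ne_top hτ ih (d k) i

theorem IsSaddle.wordMean_lyapunov_le (hzs : P.IsSaddle zs)
    (hrow : ∀ j, ∃ i, P.A j i ≠ 0) (hcol : ∀ i, 0 < P.L i ∨ ∃ j, P.A j i ≠ 0)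
    (hp : ∀ i, 0 < p i) (hp_sum : ∑ i, p i = 1) (hγ0 : 0 < γ) (hγ1 : γ < 1) (hs : 0 < s)
    (hz₀ : ∀ i, P.f i (z₀.1 i) ≠ ⊤) (a : Fin n) (k : ℕ) :
    wordMean p k (fun w => P.lyapunov p γ s zs (P.iter p γ s z₀ (extendWord a w) k)
      (P.yCheck p γ s z₀ (extendWord a w) k)) ≤ P.lyapunov p γ s zs z₀ z₀.2 := by
  induction k with
  | zero => simp [wordMean, iter, yCheck]
  | succ k ih =>
    rw [wordMean_succ]
    refine (wordMean_mono (fun i => (hp i).le) fun w => ?_).trans ih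
    refine le_trans (le_of_eq (Finset.sum_congr rfl fun b _ => ?_))
      (hzs.lyapunov_mean_le hrow hcol hp hp_sum hγ0 hγ1 hs
        (hzs.f_iter_ne_top (tau_pos hcol hp hγ0 hs) hz₀ (extendWord a w) k) _)
    have h1 : P.iter p γ s z₀ (extendWord a (Fin.snoc w b : Fin (k + 1) → Fin n)) k
        = P.iter p γ s z₀ (extendWord a w) k :=
      iter_congr fun l hl => extendWord_snoc_of_lt a b w hl
    have h2 : P.yCheck p γ s z₀ (extendWord a (Fin.snoc w b : Fin (k + 1) → Fin n)) k
        = P.yCheck p γ s z₀ (extendWord a w) k :=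
      yCheck_congr fun l hl => extendWord_snoc_of_lt a b w hl
    have h3 : P.yCheck p γ s z₀ (extendWord a (Fin.snoc w b : Fin (k + 1) → Fin n)) (k + 1)
        = P.yCheckNext p s (P.iter p γ s z₀ (extendWord a w) k)
          (P.yCheck p γ s z₀ (extendWord a w) k) b := by
      ext j
      rw [yCheck, yCheckNext, h1, h2, extendWord_snoc_self]
    rw [h3, iter, h1, extendWord_snoc_self]

end CompositeProblem

/-! ### From the Lyapunov function to the averaged iterate. -/

namespace CompositeProblem

variable {n m : ℕ} {P : CompositeProblem n m} {p : Fin n → ℝ} {γ s : ℝ}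
  {zs z z₀ : PrimalDual n m}

theorem primalWeight_nonneg (hp : ∀ i, 0 < p i) (hτ : ∀ i, 0 < P.tau p γ s i) (i : Fin n) :
    0 ≤ (p i)⁻¹ * (P.tau p γ s i)⁻¹ :=
  mul_nonneg (inv_nonneg.2 (hp i).le) (inv_nonneg.2 (hτ i).le)

theorem dualWeight_nonneg [Nonempty (Fin n)] (hp : ∀ i, 0 < p i) (hrow : ∀ j, ∃ i, P.A j i ≠ 0)
    (hs : 0 < s) (j : Fin m) : 0 ≤ (P.piProb p j)⁻¹ * (P.sigma p s j)⁻¹ :=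
  mul_nonneg (inv_nonneg.2 (piProb_pos hp (hrow j)).le)
    (inv_nonneg.2 (sigma_pos hp (hrow j) hs).le)

theorem wNormSq_nonneg (hu : ∀ i, 0 ≤ (p i)⁻¹ * (P.tau p γ s i)⁻¹)
    (hw : ∀ j, 0 ≤ (P.piProb p j)⁻¹ * (P.sigma p s j)⁻¹) (z : PrimalDual n m) :
    0 ≤ P.wNormSq p γ s z :=
  add_nonneg (Finset.sum_nonneg fun i _ => mul_nonneg (hu i) (sq_nonneg _))
    (Finset.sum_nonneg fun j _ => mul_nonneg (hw j) (sq_nonneg _))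

theorem dualNormSq_nonneg (hw : ∀ j, 0 ≤ (P.piProb p j)⁻¹ * (P.sigma p s j)⁻¹)
    (y : Fin m → ℝ) : 0 ≤ P.dualNormSq p s y :=
  Finset.sum_nonneg fun j _ => mul_nonneg (hw j) (sq_nonneg _)

theorem wNormSq_mean_le (hu : ∀ i, 0 ≤ (p i)⁻¹ * (P.tau p γ s i)⁻¹)
    (hw : ∀ j, 0 ≤ (P.piProb p j)⁻¹ * (P.sigma p s j)⁻¹) (v : ℕ → PrimalDual n m) {k : ℕ}
    (hk : 1 ≤ k) :
    P.wNormSq p γ s ((k : ℝ)⁻¹ • ∑ k' ∈ Finset.Icc 1 k, v k')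
      ≤ (k : ℝ)⁻¹ * ∑ k' ∈ Finset.Icc 1 k, P.wNormSq p γ s (v k') := by
  have hk0 : (0 : ℝ) < k := by exact_mod_cast hk
  have hsq : ∀ a : ℕ → ℝ, ((k : ℝ)⁻¹ * ∑ k' ∈ Finset.Icc 1 k, a k') ^ 2
      ≤ (k : ℝ)⁻¹ * ∑ k' ∈ Finset.Icc 1 k, a k' ^ 2 := by
    intro a
    have h := sq_sum_le_card_mul_sum_sq (s := Finset.Icc 1 k) (f := a)
    rw [Nat.card_Icc, Nat.add_sub_cancel] at h
    calc _ = ((k : ℝ)⁻¹) ^ 2 * (∑ k' ∈ Finset.Icc 1 k, a k') ^ 2 := mul_pow _ _ _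
      _ ≤ ((k : ℝ)⁻¹) ^ 2 * (k * ∑ k' ∈ Finset.Icc 1 k, a k' ^ 2) :=
        mul_le_mul_of_nonneg_left h (sq_nonneg _)
      _ = _ := by field_simp
  have e : (k : ℝ)⁻¹ * ∑ k' ∈ Finset.Icc 1 k, P.wNormSq p γ s (v k')
      = (∑ i, (p i)⁻¹ * (P.tau p γ s i)⁻¹ *
          ((k : ℝ)⁻¹ * ∑ k' ∈ Finset.Icc 1 k, (v k').1 i ^ 2))
        + ∑ j, (P.piProb p j)⁻¹ * (P.sigma p s j)⁻¹ *
          ((k : ℝ)⁻¹ * ∑ k' ∈ Finset.Icc 1 k, (v k').2 j ^ 2) := by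
    simp only [wNormSq, Finset.sum_add_distrib, mul_add, Finset.mul_sum]
    congr 1 <;>
    · rw [Finset.sum_comm]
      exact Finset.sum_congr rfl fun i _ => Finset.sum_congr rfl fun k' _ => by ring
  rw [e]
  refine add_le_add (Finset.sum_le_sum fun i _ => mul_le_mul_of_nonneg_left ?_ (hu i))
    (Finset.sum_le_sum fun j _ => mul_le_mul_of_nonneg_left ?_ (hw j))
  · simpa [Prod.fst_sum] using hsq fun k' => (v k').1 i
  · simpa [Prod.snd_sum] using hsq fun k' => (v k').2 j

/-- The factor 3 comes from the dual block, where y̌ - y_0 = (y - y*) - (y_0 - y*) - (y - y̌) has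
three terms. -/
theorem wNormSq_sub_le (hu : ∀ i, 0 ≤ (p i)⁻¹ * (P.tau p γ s i)⁻¹)
    (hw : ∀ j, 0 ≤ (P.piProb p j)⁻¹ * (P.sigma p s j)⁻¹) (zs z z₀ : PrimalDual n m)
    (yc : Fin m → ℝ) :
    P.wNormSq p γ s ((z.1, yc) - z₀)
      ≤ 3 * (P.wNormSq p γ s (z - zs) + P.wNormSq p γ s (z₀ - zs)
        + P.dualNormSq p s (z.2 - yc)) := by
  have h1 : ∑ i, (p i)⁻¹ * (P.tau p γ s i)⁻¹ * (z.1 i - z₀.1 i) ^ 2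
      ≤ ∑ i, (3 * ((p i)⁻¹ * (P.tau p γ s i)⁻¹ * (z.1 i - zs.1 i) ^ 2)
        + 3 * ((p i)⁻¹ * (P.tau p γ s i)⁻¹ * (z₀.1 i - zs.1 i) ^ 2)) :=
    Finset.sum_le_sum fun i _ => by
      have h : (z.1 i - z₀.1 i) ^ 2 ≤ 3 * (z.1 i - zs.1 i) ^ 2 + 3 * (z₀.1 i - zs.1 i) ^ 2 := by
        linarith [sq_nonneg ((z.1 i - zs.1 i) + (z₀.1 i - zs.1 i)), sq_nonneg (z.1 i - zs.1 i),
          sq_nonneg (z₀.1 i - zs.1 i)]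
      linarith [mul_le_mul_of_nonneg_left h (hu i)]
  have h2 : ∑ j, (P.piProb p j)⁻¹ * (P.sigma p s j)⁻¹ * (yc j - z₀.2 j) ^ 2
      ≤ ∑ j, (3 * ((P.piProb p j)⁻¹ * (P.sigma p s j)⁻¹ * (z.2 j - zs.2 j) ^ 2)
        + 3 * ((P.piProb p j)⁻¹ * (P.sigma p s j)⁻¹ * (z₀.2 j - zs.2 j) ^ 2)
        + 3 * ((P.piProb p j)⁻¹ * (P.sigma p s j)⁻¹ * (z.2 j - yc j) ^ 2)) :=
    Finset.sum_le_sum fun j _ => by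
      have h : (yc j - z₀.2 j) ^ 2 ≤ 3 * (z.2 j - zs.2 j) ^ 2 + 3 * (z₀.2 j - zs.2 j) ^ 2
          + 3 * (z.2 j - yc j) ^ 2 := by
        linarith [sq_nonneg ((z.2 j - zs.2 j) + (z₀.2 j - zs.2 j)),
          sq_nonneg ((z.2 j - zs.2 j) + (z.2 j - yc j)),
          sq_nonneg ((z₀.2 j - zs.2 j) - (z.2 j - yc j))]
      linarith [mul_le_mul_of_nonneg_left h (hw j)]
  simp only [Finset.sum_add_distrib, ← Finset.mul_sum] at h1 h2
  simp only [wNormSq, dualNormSq, Prod.fst_sub, Prod.snd_sub, Pi.sub_apply]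
  linarith

/-- The gap y - y̌ has the smallest coefficient in the Lyapunov function, q (1 - γ)/4, and so fixes
the constant 3 · 4 / (q (1 - γ)). -/
theorem IsSaddle.wNormSq_sub_le_lyapunov (hzs : P.IsSaddle zs)
    (hu : ∀ i, 0 ≤ (p i)⁻¹ * (P.tau p γ s i)⁻¹)
    (hw : ∀ j, 0 ≤ (P.piProb p j)⁻¹ * (P.sigma p s j)⁻¹) (hq : 0 < pMin p)
    (hγ0 : 0 < γ) (hγ1 : γ < 1) (hz : ∀ i, P.f i (z.1 i) ≠ ⊤) (hz₀ : ∀ i, P.f i (z₀.1 i) ≠ ⊤)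
    (yc : Fin m → ℝ) :
    P.wNormSq p γ s ((z.1, yc) - z₀) ≤ 12 / (pMin p * (1 - γ)) *
      (P.lyapunov p γ s zs z yc + P.lyapunov p γ s zs z₀ z₀.2) := by
  have h1γ : 0 < 1 - γ := sub_pos.2 hγ1
  have h1 := wNormSq_sub_le hu hw zs z z₀ yc
  have h2 := hzs.primalGapReal_nonneg hz
  have h3 := hzs.primalGapReal_nonneg hz₀
  have h4 := wNormSq_nonneg hu hw (z - zs)
  have h5 := wNormSq_nonneg hu hw (z₀ - zs)
  have h6 := dualNormSq_nonneg hw (z₀.2 - z₀.2)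
  have h7 := mul_nonneg (div_nonneg h1γ.le zero_le_four) (mul_nonneg hq.le h6)
  rw [div_mul_eq_mul_div, le_div_iff₀ (mul_pos hq h1γ)]
  refine (mul_le_mul_of_nonneg_right h1 (mul_pos hq h1γ).le).trans ?_
  have h8 : ∀ t : ℝ, 0 ≤ t → pMin p * (1 - γ) * t ≤ pMin p * t := fun t ht => by
    have := mul_nonneg (mul_nonneg hq.le hγ0.le) ht
    linarith
  have h9 := h8 _ h4
  have h10 := h8 _ h5
  have h11 := mul_nonneg hq.le h4
  have h12 := mul_nonneg hq.le h5
  simp only [lyapunov]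
  linarith

theorem IsSaddle.wordMean_wNormSq_avg_le (hzs : P.IsSaddle zs)
    (hrow : ∀ j, ∃ i, P.A j i ≠ 0) (hcol : ∀ i, 0 < P.L i ∨ ∃ j, P.A j i ≠ 0)
    (hp : ∀ i, 0 < p i) (hp_sum : ∑ i, p i = 1) (hγ0 : 0 < γ) (hγ1 : γ < 1) (hs : 0 < s)
    (hz₀ : ∀ i, P.f i (z₀.1 i) ≠ ⊤) (a : Fin n) {k : ℕ} (hk : 1 ≤ k) :
    wordMean p k (fun w => P.wNormSq p γ s (P.avg p γ s z₀ (extendWord a w) k - z₀))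
      ≤ 24 / (pMin p * (1 - γ)) * P.lyapunov p γ s zs z₀ z₀.2 := by
  have : Nonempty (Fin n) := ⟨a⟩
  have hτ := tau_pos (P := P) (s := s) hcol hp hγ0 hs
  have hu := primalWeight_nonneg hp hτ
  have hw := dualWeight_nonneg hp hrow hs
  have hq := pMin_pos hp
  have hk0 : (0 : ℝ) < k := by exact_mod_cast hk
  set c := 12 / (pMin p * (1 - γ)) with hc
  have hc0 : 0 ≤ c := by
    have := sub_pos.2 hγ1
    positivity
  set l₀ := P.lyapunov p γ s zs z₀ z₀.2
  set Q : ℕ → (ℕ → Fin n) → ℝ := fun k d =>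
    P.wNormSq p γ s (((P.iter p γ s z₀ d k).1, P.yCheck p γ s z₀ d k) - z₀) with hQ
  have h1 : ∀ d, P.wNormSq p γ s (P.avg p γ s z₀ d k - z₀)
      ≤ (k : ℝ)⁻¹ * ∑ k' ∈ Finset.Icc 1 k, Q k' d := by
    intro d
    have e : P.avg p γ s z₀ d k - z₀ = (k : ℝ)⁻¹ • ∑ k' ∈ Finset.Icc 1 k,
        (((P.iter p γ s z₀ d k').1, P.yCheck p γ s z₀ d k') - z₀) := by
      rw [Finset.sum_sub_distrib, Finset.sum_const, Nat.card_Icc, Nat.add_sub_cancel, smul_sub,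
        ← Nat.cast_smul_eq_nsmul ℝ, smul_smul, inv_mul_cancel₀ hk0.ne', one_smul, avg]
    rw [e]
    exact wNormSq_mean_le hu hw _ hk
  -- The bound involves the Lyapunov function at time k' and at time 0; both have mean at most `l₀`,
  -- hence the factor 2.
  have h2 : ∀ k', wordMean p k' (fun w => Q k' (extendWord a w)) ≤ 2 * c * l₀ := by
    intro k'
    refine (wordMean_mono (fun i => (hp i).le) fun w => hzs.wNormSq_sub_le_lyapunov hu hw hq hγ0
      hγ1 (hzs.f_iter_ne_top hτ hz₀ (extendWord a w) k') hz₀ _).trans ?_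
    rw [wordMean_const_mul, wordMean_add, wordMean_const hp_sum]
    have h3 := hzs.wordMean_lyapunov_le hrow hcol hp hp_sum hγ0 hγ1 hs hz₀ a k'
    have h4 := mul_le_mul_of_nonneg_left (add_le_add_left h3 l₀) hc0
    refine h4.trans (le_of_eq ?_)
    ring
  refine (wordMean_mono (fun i => (hp i).le) fun w => h1 _).trans ?_
  rw [wordMean_const_mul, wordMean_sum_init hp_sum a Q]
  · have h5 := Finset.sum_le_sum fun k' (_ : k' ∈ Finset.Icc 1 k) => h2 k'
    rw [Finset.sum_const, Nat.card_Icc, Nat.add_sub_cancel, nsmul_eq_mul] at h5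
    have h6 := mul_le_mul_of_nonneg_left h5 (inv_nonneg.2 hk0.le)
    refine h6.trans (le_of_eq ?_)
    rw [inv_mul_cancel_left₀ hk0.ne', hc]
    ring
  · intro k d d' h
    simp only [hQ]
    rw [iter_congr h, yCheck_congr h]

theorem sum_eq_coe_sum_toReal {x : Fin n → ℝ} (hx : ∀ i, P.f i (x i) ≠ ⊤) :
    ∑ i, P.f i (x i) = ((∑ i, (P.f i (x i)).toReal : ℝ) : EReal) := by
  refine Eq.trans ?_ (map_sum (⟨⟨Real.toEReal, rfl⟩, EReal.coe_add⟩ : ℝ →+ EReal) _ _).symm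
  exact Finset.sum_congr rfl fun i _ => (EReal.coe_toReal (hx i) ((P.f_proper i).ne_bot _)).symm

theorem sum_eq_top {x : Fin n → ℝ} {i : Fin n} (hx : P.f i (x i) = ⊤) :
    ∑ i, P.f i (x i) = ⊤ := by
  rw [← Finset.add_sum_erase _ _ (Finset.mem_univ i), hx]
  refine EReal.top_add_of_ne_bot ?_
  refine Finset.sum_induction _ (· ≠ ⊥) (fun a b ha hb => ?_) EReal.zero_ne_bot
    fun i _ => (P.f_proper i).ne_bot _
  rw [Ne, EReal.add_eq_bot_iff]
  tauto

/-- With y̌ = y the error term vanishes, so the Lyapunov function starts exactly at Δ. -/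
theorem IsSaddle.Delta_eq_coe (hzs : P.IsSaddle zs) (hz : ∀ i, P.f i (z.1 i) ≠ ⊤) :
    P.Delta p γ s zs z = (P.lyapunov p γ s zs z z.2 : EReal) := by
  rw [Delta, primalGap, sum_eq_coe_sum_toReal hz, sum_eq_coe_sum_toReal fun i => (hzs.1 i).1]
  simp only [← EReal.coe_sub, ← EReal.coe_add]
  congr 1
  simp [lyapunov, primalGapReal, dualNormSq]

theorem IsSaddle.Delta_eq_top (hzs : P.IsSaddle zs) {i : Fin n} (hz : P.f i (z.1 i) = ⊤) :
    P.Delta p γ s zs z = ⊤ := by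
  rw [Delta, primalGap, sum_eq_top hz, sum_eq_coe_sum_toReal fun i => (hzs.1 i).1]
  rfl

end CompositeProblem

/-! ### Conditional expectation over the draws. -/

section Conditional

/-- The conditional expectation of a function of finitely many draws and of a parameter known at
the beginning: average over the draws, with the parameter frozen. -/
theorem condLExp_draws_ae_eq {Ω α : Type*} [Fintype α] [MeasurableSpace α]
    [MeasurableSingletonClass α] {𝓕 mΩ : MeasurableSpace Ω} {μ : Measure Ω}
    [IsProbabilityMeasure μ] (h𝓕 : 𝓕 ≤ mΩ) {d : ℕ → Ω → α} (hd : ∀ k, Measurable (d k))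
    (hind : iIndepFun d μ) {q : α → ℝ≥0∞} (hq : ∀ k a, μ (d k ⁻¹' {a}) = q a)
    (h𝓕d : Indep 𝓕 (⨆ k, MeasurableSpace.comap (d k) ‹MeasurableSpace α›) μ) (k : ℕ)
    {G : (Fin k → α) → Ω → ℝ≥0∞} (hG : ∀ w, Measurable[𝓕] (G w)) :
    (fun ω => ∑ w, (∏ l, q (w l)) * G w ω)
      =ᵐ[μ] condLExp 𝓕 μ fun ω => G (fun l => d l ω) ω := by
  classical
  have hE : ∀ w : Fin k → α,
      MeasurableSet[⨆ k, MeasurableSpace.comap (d k) ‹MeasurableSpace α›]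
        (⋂ l : Fin k, d l ⁻¹' {w l}) := fun w =>
    MeasurableSet.iInter fun l =>
      le_iSup (fun k => MeasurableSpace.comap (d k) ‹MeasurableSpace α›) (l : ℕ) _
        ⟨{w l}, measurableSet_singleton _, rfl⟩
  have hle : (⨆ k, MeasurableSpace.comap (d k) ‹MeasurableSpace α›) ≤ mΩ :=
    iSup_le fun k => (hd k).comap_le
  have hμE : ∀ w : Fin k → α, μ (⋂ l : Fin k, d l ⁻¹' {w l}) = ∏ l, q (w l) := by
    intro w
    have h := (hind.precomp Fin.val_injective).measure_inter_preimage_eq_mul Finset.univ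
      (sets := fun l : Fin k => {w l}) fun l _ => measurableSet_singleton _
    simpa [hq] using h
  refine ae_eq_condLExp h𝓕 μ _ (Finset.measurable_fun_sum _ fun w _ => (hG w).const_mul _) ?_
  intro B hB
  -- Split according to the observed word: exactly one cylinder event contains ω.
  have e : ∀ ω, G (fun l => d l ω) ω
      = ∑ w, G w ω * (⋂ l : Fin k, d l ⁻¹' {w l}).indicator (fun _ => 1) ω := by
    intro ω
    rw [Finset.sum_eq_single fun l : Fin k => d l ω]
    · rw [Set.indicator_of_mem (by simp), mul_one]
    · intro w _ hw
      rw [Set.indicator_of_notMem, mul_zero]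
      intro h
      refine hw (funext fun l => ?_)
      exact (Set.mem_iInter.1 h l).symm
    · simp
  have hG' : ∀ w, Measurable[mΩ] (G w) := fun w => (hG w).mono h𝓕 le_rfl
  have hB' := h𝓕 _ hB
  simp only [e]
  have hF : ∀ w ∈ Finset.univ, Measurable[mΩ] fun ω =>
      G w ω * (⋂ l : Fin k, d l ⁻¹' {w l}).indicator (fun _ => (1 : ℝ≥0∞)) ω := fun w _ =>
    (hG' w).mul (measurable_const.indicator (hle _ (hE w)))
  rw [lintegral_finsetSum _ fun w _ => (hG' w).const_mul _, lintegral_finsetSum _ hF]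
  refine Finset.sum_congr rfl fun w _ => ?_
  -- The cylinder lies in the σ-algebra of the draws, so its indicator factors out of the integral
  -- over an initial event.
  have hI : IndepSets {t | MeasurableSet[𝓕] t} {⋂ l : Fin k, d l ⁻¹' {w l}} μ := by
    rw [IndepSets_iff]
    rintro t₁ t₂ h₁ rfl
    exact (Indep_iff _ _ _).1 h𝓕d _ _ h₁ (hE w)
  have h := lintegral_mul_indicator_eq_lintegral_mul_lintegral_indicator h𝓕 1
    (hle _ (hE w)) hI ((hG w).indicator hB)
  rw [lintegral_indicator_const (hle _ (hE w)), one_mul, hμE, lintegral_indicator hB'] at h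
  rw [lintegral_const_mul _ (hG' w), mul_comm, ← h, ← lintegral_indicator hB']
  refine lintegral_congr fun ω => ?_
  by_cases hω : ω ∈ B <;> simp [hω]

end Conditional

/-! ### Measurability of the iterates for a fixed word; a saddle point makes the prox maps well
defined. -/

namespace CompositeProblem

variable {n m : ℕ} {P : CompositeProblem n m} {p : Fin n → ℝ} {γ : ℝ} {zs : PrimalDual n m}
variable {Ω : Type*} [MeasurableSpace Ω] {s : Ω → ℝ} {z : Ω → PrimalDual n m}

theorem measurable_sigma (hs : Measurable s) (j : Fin m) :
    Measurable fun ω => P.sigma p (s ω) j := by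
  unfold sigma; fun_prop

theorem measurable_tau (hs : Measurable s) (i : Fin n) :
    Measurable fun ω => P.tau p γ (s ω) i := by
  unfold tau; fun_prop

theorem measurable_mulVec {k l : ℕ} (M : Matrix (Fin k) (Fin l) ℝ) {v : Ω → Fin l → ℝ}
    (hv : Measurable v) : Measurable fun ω => M *ᵥ v ω := by
  refine measurable_pi_lambda _ fun j => ?_
  unfold Matrix.mulVec dotProduct
  fun_prop

theorem measurable_grad₂ {x : Ω → Fin n → ℝ} (hx : Measurable x) (i : Fin n) :
    Measurable fun ω => P.grad₂ (x ω) i :=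
  (measurable_fderiv_apply_const ℝ P.f₂ (Pi.single i 1)).comp hx

theorem IsSaddle.measurable_yBar (hzs : P.IsSaddle zs) (hs : Measurable s) (hz : Measurable z)
    (hσ : ∀ ω j, 0 < P.sigma p (s ω) j) : Measurable fun ω => P.yBar p (s ω) (z ω) := by
  refine measurable_pi_lambda _ fun j => ?_
  have h1 := measurable_mulVec P.A hz.fst
  have h2 := measurable_sigma (P := P) (p := p) hs j
  have h3 := hz.snd
  exact (hzs.conj_proper j).measurable_prox (hzs.2 j) h2 (fun ω => hσ ω j) (by fun_prop)

theorem IsSaddle.measurable_xBar (hzs : P.IsSaddle zs) (hs : Measurable s) (hz : Measurable z)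
    (hσ : ∀ ω j, 0 < P.sigma p (s ω) j) (hτ : ∀ ω i, 0 < P.tau p γ (s ω) i) :
    Measurable fun ω => P.xBar p γ (s ω) (z ω) := by
  refine measurable_pi_lambda _ fun i => ?_
  have h1 := measurable_mulVec P.Aᵀ (hzs.measurable_yBar hs hz hσ)
  have h2 := measurable_tau (P := P) (p := p) (γ := γ) hs i
  have h3 := hz.fst
  have h4 := measurable_grad₂ (P := P) hz.fst i
  exact (P.f_proper i).measurable_prox (hzs.1 i) h2 (fun ω => hτ ω i) (by fun_prop)

theorem IsSaddle.measurable_xNext (hzs : P.IsSaddle zs) (hs : Measurable s) (hz : Measurable z)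
    (hσ : ∀ ω j, 0 < P.sigma p (s ω) j) (hτ : ∀ ω i, 0 < P.tau p γ (s ω) i) (k : Fin n) :
    Measurable fun ω => P.xNext p γ (s ω) (z ω) k := by
  refine measurable_pi_lambda _ fun i => ?_
  have h1 := hzs.measurable_xBar hs hz hσ hτ
  have h3 := hz.fst
  by_cases h : i = k
  · subst h
    simp only [xNext, Function.update_self]
    fun_prop
  · simp only [xNext, Function.update_of_ne h]
    fun_prop

theorem IsSaddle.measurable_yNext (hzs : P.IsSaddle zs) (hs : Measurable s) (hz : Measurable z)
    (hσ : ∀ ω j, 0 < P.sigma p (s ω) j) (hτ : ∀ ω i, 0 < P.tau p γ (s ω) i) (k : Fin n) :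
    Measurable fun ω => P.yNext p γ (s ω) (z ω) k := by
  refine measurable_pi_lambda _ fun j => ?_
  have h1 := hzs.measurable_yBar hs hz hσ
  have h2 := measurable_mulVec P.A ((hzs.measurable_xNext hs hz hσ hτ k).sub hz.fst)
  have h3 := hz.snd
  have h4 := measurable_sigma (P := P) (p := p) hs j
  by_cases h : P.A j k ≠ 0
  · simp only [yNext, if_pos h]
    simp only [Pi.sub_apply] at h2
    fun_prop
  · simp only [yNext, if_neg h]
    fun_prop

theorem IsSaddle.measurable_iter (hzs : P.IsSaddle zs) (hs : Measurable s) (hz : Measurable z)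
    (hσ : ∀ ω j, 0 < P.sigma p (s ω) j) (hτ : ∀ ω i, 0 < P.tau p γ (s ω) i) (d : ℕ → Fin n)
    (k : ℕ) : Measurable fun ω => P.iter p γ (s ω) (z ω) d k := by
  induction k with
  | zero => exact hz
  | succ k ih =>
    exact (hzs.measurable_xNext hs ih hσ hτ (d k)).prodMk (hzs.measurable_yNext hs ih hσ hτ (d k))

theorem IsSaddle.measurable_yCheck (hzs : P.IsSaddle zs) (hs : Measurable s) (hz : Measurable z)
    (hσ : ∀ ω j, 0 < P.sigma p (s ω) j) (hτ : ∀ ω i, 0 < P.tau p γ (s ω) i) (d : ℕ → Fin n)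
    (k : ℕ) : Measurable fun ω => P.yCheck p γ (s ω) (z ω) d k := by
  induction k with
  | zero => exact hz.snd
  | succ k ih =>
    have h1 := hzs.measurable_yBar hs (hzs.measurable_iter hs hz hσ hτ d k) hσ
    refine measurable_pi_lambda _ fun j => ?_
    by_cases h : P.A j (d k) ≠ 0
    · simp only [yCheck, if_pos h]
      fun_prop
    · simp only [yCheck, if_neg h]
      fun_prop

theorem IsSaddle.measurable_avg (hzs : P.IsSaddle zs) (hs : Measurable s) (hz : Measurable z)
    (hσ : ∀ ω j, 0 < P.sigma p (s ω) j) (hτ : ∀ ω i, 0 < P.tau p γ (s ω) i) (d : ℕ → Fin n)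
    (k : ℕ) : Measurable fun ω => P.avg p γ (s ω) (z ω) d k := by
  have h : Measurable fun ω => ∑ k' ∈ Finset.Icc 1 k,
      ((P.iter p γ (s ω) (z ω) d k').1, P.yCheck p γ (s ω) (z ω) d k') :=
    Finset.measurable_fun_sum _ fun k' _ => (hzs.measurable_iter hs hz hσ hτ d k').fst.prodMk
      (hzs.measurable_yCheck hs hz hσ hτ d k')
  unfold avg
  exact Measurable.const_smul h ((k : ℝ)⁻¹)

theorem measurable_wNormSq (hs : Measurable s) (hz : Measurable z) :
    Measurable fun ω => P.wNormSq p γ (s ω) (z ω) := by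
  have h1 := fun i => measurable_tau (P := P) (p := p) (γ := γ) hs i
  have h2 := fun j => measurable_sigma (P := P) (p := p) hs j
  have h3 := hz.fst
  have h4 := hz.snd
  unfold wNormSq
  fun_prop

theorem IsSaddle.measurable_wNormSq_avg_sub (hzs : P.IsSaddle zs) (hs : Measurable s)
    (hz : Measurable z) (hσ : ∀ ω j, 0 < P.sigma p (s ω) j) (hτ : ∀ ω i, 0 < P.tau p γ (s ω) i)
    (d : ℕ → Fin n) (k : ℕ) :
    Measurable fun ω => P.wNormSq p γ (s ω) (P.avg p γ (s ω) (z ω) d k - z ω) :=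
  measurable_wNormSq hs ((hzs.measurable_avg hs hz hσ hτ d k).sub hz)

end CompositeProblem

end

theorem lemma2 {n m : ℕ} (P : CompositeProblem n m)
    (hrow : ∀ j, ∃ i, P.A j i ≠ 0)
    (hcol : ∀ i, 0 < P.L i ∨ ∃ j, P.A j i ≠ 0)
    (p : Fin n → ℝ) (hp : ∀ i, 0 < p i) (hp_sum : ∑ i, p i = 1)
    (γ : ℝ) (hγ_pos : 0 < γ) (hγ_lt : γ < 1) :
    ∃ C : ℝ, 0 < C ∧
      ∀ {Ω : Type*} (𝓕 : MeasurableSpace Ω) [mΩ : MeasurableSpace Ω] (μ : Measure Ω)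
        [IsProbabilityMeasure μ] (_ : 𝓕 ≤ mΩ)
        -- step-size parameter and starting point of the stage, known at its beginning
        (s : Ω → ℝ) (_ : Measurable[𝓕] s) (_ : ∀ ω, 0 < s ω)
        (z₀ : Ω → PrimalDual n m) (_ : Measurable[𝓕] z₀)
        -- the coordinates drawn during the stage: i.i.d. with law `p`, independent of the past
        (d : ℕ → Ω → Fin n) (_ : ∀ k, Measurable (d k))
        (_ : ∀ k i, μ (d k ⁻¹' {i}) = ENNReal.ofReal (p i))
        (_ : iIndepFun d μ)
        (_ : Indep 𝓕 (⨆ k, MeasurableSpace.comap (d k) ⊤) μ)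
        (k : ℕ) (_ : 1 ≤ k),
        ∀ᵐ ω ∂μ, ∀ zs : PrimalDual n m, P.IsSaddle zs →
          ((condLExp 𝓕 μ (fun ω' => ENNReal.ofReal (P.wNormSq p γ (s ω')
            (P.avg p γ (s ω') (z₀ ω') (fun l => d l ω') k - z₀ ω'))) ω : ℝ≥0∞) : EReal)
          ≤ (C : EReal) * P.Delta p γ (s ω) zs (z₀ ω) := by
  have hne : Nonempty (Fin n) := by
    by_contra h
    rw [not_nonempty_iff] at h
    simp at hp_sum
  obtain ⟨a⟩ := id hne
  have hC : 0 < 24 / (CompositeProblem.pMin p * (1 - γ)) :=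
    div_pos (by norm_num) (mul_pos (CompositeProblem.pMin_pos hp) (sub_pos.2 hγ_lt))
  refine ⟨_, hC, ?_⟩
  intro Ω 𝓕 mΩ μ _ h𝓕 s hs hs0 z₀ hz₀ d hd hlaw hind h𝓕d k hk
  -- Without a saddle point the claim is vacuous. Otherwise any one of them serves for
  -- measurability, independently of the later choice of `zs`.
  by_cases hex : ∃ zs, P.IsSaddle zs
  swap
  · exact Filter.Eventually.of_forall fun ω zs hzs => absurd ⟨zs, hzs⟩ hex
  obtain ⟨zs', hzs'⟩ := hex
  have hσ : ∀ ω j, 0 < P.sigma p (s ω) j := fun ω j =>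
    CompositeProblem.sigma_pos hp (hrow j) (hs0 ω)
  have hτ : ∀ ω i, 0 < P.tau p γ (s ω) i := fun ω i =>
    CompositeProblem.tau_pos hcol hp hγ_pos (hs0 ω) i
  have key := condLExp_draws_ae_eq h𝓕 hd hind hlaw h𝓕d k
    (G := fun w ω => ENNReal.ofReal (P.wNormSq p γ (s ω)
      (P.avg p γ (s ω) (z₀ ω) (extendWord a w) k - z₀ ω)))
    fun w => ENNReal.measurable_ofReal.comp (@CompositeProblem.IsSaddle.measurable_wNormSq_avg_sub
      n m P p γ zs' Ω 𝓕 s z₀ hzs' hs hz₀ hσ hτ (extendWord a w) k)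
  have e : (fun ω => ENNReal.ofReal (P.wNormSq p γ (s ω)
        (P.avg p γ (s ω) (z₀ ω) (extendWord a fun l : Fin k => d l ω) k - z₀ ω)))
      = fun ω => ENNReal.ofReal (P.wNormSq p γ (s ω)
        (P.avg p γ (s ω) (z₀ ω) (fun l => d l ω) k - z₀ ω)) := by
    ext ω
    have : P.avg p γ (s ω) (z₀ ω) (extendWord a fun l : Fin k => d l ω) k
        = P.avg p γ (s ω) (z₀ ω) (fun l => d l ω) k :=
      CompositeProblem.avg_congr fun l hl => by simp [extendWord, hl]
    rw [this]
  rw [e] at key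
  filter_upwards [key] with ω hω zs hzs
  rw [← hω]
  -- Outside the domain of f the right-hand side is +∞.
  by_cases hz : ∃ i, P.f i ((z₀ ω).1 i) = ⊤
  · obtain ⟨i, hi⟩ := hz
    rw [hzs.Delta_eq_top hi, EReal.mul_top_of_pos (EReal.coe_pos.2 hC)]
    exact le_top
  push Not at hz
  have hu := CompositeProblem.primalWeight_nonneg hp (hτ ω)
  have hw := CompositeProblem.dualWeight_nonneg hp hrow (hs0 ω)
  have hsum : ∑ w : Fin k → Fin n, (∏ l, ENNReal.ofReal (p (w l))) *
      ENNReal.ofReal (P.wNormSq p γ (s ω)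
        (P.avg p γ (s ω) (z₀ ω) (extendWord a w) k - z₀ ω))
      = ENNReal.ofReal (wordMean p k fun w => P.wNormSq p γ (s ω)
        (P.avg p γ (s ω) (z₀ ω) (extendWord a w) k - z₀ ω)) := by
    have hprod : ∀ w : Fin k → Fin n, 0 ≤ ∏ l, p (w l) := fun w =>
      Finset.prod_nonneg fun _ _ => (hp _).le
    rw [wordMean, ENNReal.ofReal_sum_of_nonneg fun w _ =>
      mul_nonneg (hprod w) (CompositeProblem.wNormSq_nonneg hu hw _)]
    refine Finset.sum_congr rfl fun w _ => ?_
    rw [ENNReal.ofReal_mul (hprod w), ENNReal.ofReal_prod_of_nonneg fun _ _ => (hp _).le]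
  rw [hsum, hzs.Delta_eq_coe hz, ← EReal.coe_mul, EReal.coe_ennreal_ofReal, EReal.coe_le_coe_iff]
  have hbound := hzs.wordMean_wNormSq_avg_le hrow hcol hp hp_sum hγ_pos hγ_lt (hs0 ω) hz a hk
  -- The coercion of `ENNReal.ofReal` produces a maximum with 0, so nonnegativity of the bound is
  -- also needed.
  refine max_le hbound (le_trans ?_ hbound)
  exact Finset.sum_nonneg fun w _ => mul_nonneg (Finset.prod_nonneg fun _ _ => (hp _).le)
    (CompositeProblem.wNormSq_nonneg hu hw _)
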